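/- A graph $G=(V,E)$ is a set $V$ (possibly infinite) with a symmetric set of edges $E\subset V\times V$ (loops $(x,x)$ allowed); a graph map is a map of vertices that preserves edges. Put $N(x)=\{y\mid (x,y)\in E\}$, $N_0(x)=\{x\}$ and $N_{r}(x)=\bigcup_{w\in N_{r-1}(x)}N(w)$. The $r$-neighborhood complex $\mathcal N_r(G)$ is the abstract simplicial complex whose simplices are the finite non-empty sets $\sigma\subset V$ with $\sigma\subset N_r(w)$ for some $w\in V$; $|\mathcal N_r(G)|$ denotes its geometric realization (with the weak topology). A path of length $n$ from $x$ to $y$ in $G$ is a sequence $\varphi(0)=x,\varphi(1),\dots,\varphi(n)=y$ of vertices with $(\varphi(i),\varphi(i+1))\in E$ for $0\le i<n$. For $s\ge 1$, $s$-homotopy is the equivalence relation on the paths from $x$ to $y$ generated by the pairs $(\varphi,\psi)$ such that either (i) $\psi$ has length $n+2$, where $n$ is the length of $\varphi$, and there is $k\in\{0,\dots,n\}$ with $\varphi(i)=\psi(i)$ for $i\le k$ and $\varphi(i)=\psi(i+2)$ for $k\le i\le n$; or (ii) $\varphi$ and $\psi$ have the same length and there is $k\ge 0$ with $\varphi(i)=\psi(i)$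 for all $i\notin\{k,k+1,\dots,k+s-2\}$. The $s$-fundamental group $\pi_1^s(G,v)$ is the group of $s$-homotopy classes of loops at $v$ (paths from $v$ to $v$) under concatenation, and $\pi_1^{s}(G,v)_{\mathrm{ev}}$ is its subgroup of the classes of loops of even length. **Theorem 5.2 (Main Theorem 2).** Let $r\ge 1$ be an integer. For every based graph $(G,v)$ with $v$ not isolated, i.e. $N(v)\ne\emptyset$, there is an isomorphism of groups $$\Phi_{(G,v)}:\pi_1(|\mathcal N_r(G)|,v)\;\xrightarrow{\ \cong\ }\;\pi_1^{2r}(G,v)_{\mathrm{ev}},$$ and these isomorphisms can be chosen natural in $(G,v)$: for every graph map $f:G\to H$ one has $f_*\circ\Phi_{(G,v)}=\Phi_{(H,f(v))}\circ |f|_*$, where $|f|_*:\pi_1(|\mathcal N_r(G)|,v)\to\pi_1(|\mathcal N_r(H)|,f(v))$ and $f_*:\pi_1^{2r}(G,v)_{\mathrm{ev}}\to\pi_1^{2r}(H,f(v))_{\mathrm{ev}}$ are the induced homomorphisms. -/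

import Mathlib

universe u v

noncomputable section

/-! ### Simplicial complexes and their geometric realization -/

namespace PreAbstractSimplicialComplex

variable {V : Type u} {W : Type v}

/-- The points of the geometric realization `|K|`: formal convex combinations of vertices (in
barycentric coordinates) whose support is a simplex of `K`. -/
@[ext]
structure Realization (K : PreAbstractSimplicialComplex V) : Type u where
  /-- the barycentric coordinates -/
  pt : Convexity.StdSimplex ℝ V
  /-- the support is a simplex -/
  support_mem : pt.weights.support ∈ K.faces

/-- The closed simplex `|σ|` inside `|K|`: the points supported in `σ`. -/
structure ClosedSimplex (K : PreAbstractSimplicialComplex V) (σ : Finset V) : Type u where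
  /-- the inclusion into `|K|` -/
  incl : K.Realization
  /-- the support lies in `σ` -/
  support_subset : incl.pt.weights.support ⊆ σ

/-- The Euclidean topology on a closed simplex (the topology of the barycentric coordinates). -/
instance (K : PreAbstractSimplicialComplex V) (σ : Finset V) :
    TopologicalSpace (K.ClosedSimplex σ) :=
  TopologicalSpace.induced (fun x => (fun a => x.incl.pt.weights a : V → ℝ)) inferInstance

/-- The weak (coherent) topology on `|K|`: the finest topology for which the inclusions of all the
closed simplices `|σ|`, `σ ∈ K`, are continuous. -/
instance (K : PreAbstractSimplicialComplex V) : TopologicalSpace K.Realization :=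
  ⨆ σ : K.faces, TopologicalSpace.coinduced
    (ClosedSimplex.incl : K.ClosedSimplex σ.1 → K.Realization) inferInstance

/-- A vertex of `K` as a point of `|K|`. -/
def vertexPt (K : PreAbstractSimplicialComplex V) (a : V) (ha : {a} ∈ K.faces) :
    K.Realization where
  pt := .single a
  support_mem := by
    rw [Convexity.StdSimplex.support_weights_eq_singleton.2 rfl]; exact ha

/-- `f` is a simplicial map from `K` to `L`. -/
def IsSimplicialMap (K : PreAbstractSimplicialComplex V) (L : PreAbstractSimplicialComplex W)
    (f : V → W) : Prop :=
  ∀ (σ : Finset V) (τ : Finset W), σ ∈ K.faces → (τ : Set W) = f '' σ → τ ∈ L.faces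

theorem support_map_subset (f : V → W) (x : Convexity.StdSimplex ℝ V) (σ : Finset V)
    (h : x.weights.support ⊆ σ) (τ : Finset W) (hτ : (τ : Set W) = f '' σ) :
    (x.map f).weights.support ⊆ τ := by
  classical
  intro b hb
  rw [Convexity.StdSimplex.weights_map] at hb
  have hb' := Finsupp.mapDomain_support hb
  obtain ⟨a, ha, rfl⟩ := Finset.mem_image.1 hb'
  rw [← Finset.mem_coe, hτ]
  exact ⟨a, h ha, rfl⟩

/-- The map of realizations `|f| : |K| → |L|` induced by a simplicial map: affine on each simplex
and equal to `f` on the vertices. -/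
def realizationFun {K : PreAbstractSimplicialComplex V} {L : PreAbstractSimplicialComplex W}
    {f : V → W} (hf : IsSimplicialMap K L f) (x : K.Realization) : L.Realization where
  pt := x.pt.map f
  support_mem := by
    classical
    have h1 : x.pt.weights.support.image f ∈ L.faces :=
      hf _ _ x.support_mem (by simp)
    exact (L.isRelLowerSet_faces h1).2
      (support_map_subset f x.pt _ subset_rfl _ (by simp))
      (Convexity.StdSimplex.support_weights_nonempty _)

theorem continuous_realizationFun {K : PreAbstractSimplicialComplex V}
    {L : PreAbstractSimplicialComplex W} {f : V → W} (hf : IsSimplicialMap K L f) :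
    Continuous (realizationFun hf) := by
  classical
  rw [continuous_iSup_dom]
  intro σ
  rw [continuous_coinduced_dom]
  have hτ : ((σ.1.image f : Finset W) : Set W) = f '' σ.1 := by simp
  have hτL : σ.1.image f ∈ L.faces := hf _ _ σ.2 hτ
  let g : K.ClosedSimplex σ.1 → L.ClosedSimplex (σ.1.image f) := fun x =>
    ⟨realizationFun hf x.incl, support_map_subset f x.incl.pt _ x.2 _ hτ⟩
  have hg : Continuous g := by
    rw [continuous_induced_rng, continuous_pi_iff]
    intro b
    have hcoord : ∀ a : V, Continuous fun x : K.ClosedSimplex σ.1 => x.incl.pt.weights a :=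
      fun a => (continuous_apply a).comp continuous_induced_dom
    have hsum : ∀ x : K.ClosedSimplex σ.1, (x.incl.pt.map f).weights b
        = ∑ a ∈ σ.1, if f a = b then x.incl.pt.weights a else 0 := by
      intro x
      rw [Convexity.StdSimplex.weights_map, Finsupp.mapDomain, Finsupp.sum_apply,
        Finsupp.sum_of_support_subset _ x.2 _ (by simp)]
      exact Finset.sum_congr rfl fun a _ => by rw [Finsupp.single_apply]
    have h2 : Continuous fun x : K.ClosedSimplex σ.1 =>
        ∑ a ∈ σ.1, if f a = b then x.incl.pt.weights a else 0 := by
      refine continuous_finsetSum _ fun a _ => ?_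
      split_ifs
      · exact hcoord a
      · exact continuous_const
    exact h2.congr fun x => (hsum x).symm
  have hval : Continuous (ClosedSimplex.incl : L.ClosedSimplex (σ.1.image f) → L.Realization) := by
    rw [continuous_iff_coinduced_le]
    exact le_iSup (fun τ : L.faces => TopologicalSpace.coinduced
      (ClosedSimplex.incl : L.ClosedSimplex τ.1 → L.Realization) inferInstance) ⟨_, hτL⟩
  exact hval.comp hg

/-- `|f| : |K| → |L|` as a continuous map. -/
def realizationMap {K : PreAbstractSimplicialComplex V} {L : PreAbstractSimplicialComplex W}
    {f : V → W} (hf : IsSimplicialMap K L f) : C(K.Realization, L.Realization) :=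
  ⟨realizationFun hf, continuous_realizationFun hf⟩

theorem realizationMap_vertexPt {K : PreAbstractSimplicialComplex V}
    {L : PreAbstractSimplicialComplex W} {f : V → W} (hf : IsSimplicialMap K L f)
    (a : V) (ha : {a} ∈ K.faces) (hb : {f a} ∈ L.faces) :
    realizationMap hf (K.vertexPt a ha) = L.vertexPt (f a) hb :=
  Realization.ext (Convexity.StdSimplex.map_single a f)

end PreAbstractSimplicialComplex

/-! ### Graphs: a symmetric set of edges, loops at vertices allowed, any set of vertices -/

/-- A graph with vertex set `V`: the edges form a symmetric relation on `V`. -/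
structure SymGraph (V : Type u) where
  /-- the edge relation -/
  Adj : V → V → Prop
  /-- it is symmetric -/
  symm : ∀ {x y : V}, Adj x y → Adj y x

namespace SymGraph

variable {V : Type u} {W : Type v}

/-- Graph maps: maps of the vertices that preserve edges. -/
structure Hom (G : SymGraph V) (H : SymGraph W) where
  /-- the map of the vertices -/
  toFun : V → W
  /-- edges go to edges -/
  map_adj : ∀ {x y : V}, G.Adj x y → H.Adj (toFun x) (toFun y)

instance (G : SymGraph V) (H : SymGraph W) : CoeFun (Hom G H) (fun _ => V → W) :=
  ⟨Hom.toFun⟩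

/-- The set `N(x)` of the neighbors of `x`. -/
def nbrs (G : SymGraph V) (x : V) : Set V := {y | G.Adj x y}

/-- The `r`-th neighborhood: `N_0(x) = {x}` and `N_{r+1}(x) = ⋃_{w ∈ N_r(x)} N(w)`. -/
def nbhd (G : SymGraph V) : ℕ → V → Set V
  | 0, x => {x}
  | r + 1, x => ⋃ w ∈ G.nbhd r x, G.nbrs w

/-- The `r`-neighborhood complex: the finite non-empty sets of vertices contained in some
`N_r(w)`. -/
def nbhdComplex (G : SymGraph V) (r : ℕ) : PreAbstractSimplicialComplex V where
  faces := {σ | σ.Nonempty ∧ ∃ w : V, (σ : Set V) ⊆ G.nbhd r w}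
  isRelLowerSet_faces := by
    rintro σ ⟨hσ, w, hw⟩
    refine ⟨hσ, fun τ hτσ hτ => ⟨hτ, w, fun x hx => hw (hτσ hx)⟩⟩

theorem exists_mem_nbhd (G : SymGraph V) (r : ℕ) :
    ∀ x : V, (G.nbrs x).Nonempty → ∃ w, x ∈ G.nbhd r w := by
  induction r with
  | zero => exact fun x _ => ⟨x, rfl⟩
  | succ r ih =>
    rintro x ⟨y, hy⟩
    obtain ⟨w, hw⟩ := ih y ⟨x, G.symm hy⟩
    exact ⟨w, Set.mem_biUnion hw (G.symm hy)⟩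

theorem singleton_mem_nbhdComplex (G : SymGraph V) (r : ℕ) {x : V} (hx : (G.nbrs x).Nonempty) :
    {x} ∈ (G.nbhdComplex r).faces := by
  obtain ⟨w, hw⟩ := G.exists_mem_nbhd r x hx
  exact ⟨Finset.singleton_nonempty x, w, by simpa using hw⟩

/-- The base point of `|N_r(G)|` given by a vertex that is not isolated. -/
def basePt (G : SymGraph V) (r : ℕ) (x : V) (hx : (G.nbrs x).Nonempty) :
    (G.nbhdComplex r).Realization :=
  (G.nbhdComplex r).vertexPt x (G.singleton_mem_nbhdComplex r hx)

namespace Hom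

variable {G : SymGraph V} {H : SymGraph W}

theorem nbrs_nonempty (f : Hom G H) {x : V} (hx : (G.nbrs x).Nonempty) :
    (H.nbrs (f x)).Nonempty := by
  obtain ⟨y, hy⟩ := hx
  exact ⟨f y, f.map_adj hy⟩

theorem mem_nbhd (f : Hom G H) {r : ℕ} {w : V} :
    ∀ {x : V}, x ∈ G.nbhd r w → f x ∈ H.nbhd r (f w) := by
  induction r with
  | zero => rintro x rfl; rfl
  | succ r ih =>
    intro x hx
    obtain ⟨y, hy, hxy⟩ := Set.mem_iUnion₂.1 hx
    exact Set.mem_biUnion (ih hy) (f.map_adj hxy)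

theorem isSimplicialMap (f : Hom G H) (r : ℕ) :
    PreAbstractSimplicialComplex.IsSimplicialMap (G.nbhdComplex r) (H.nbhdComplex r) f := by
  rintro σ τ ⟨hσ, w, hw⟩ hτ
  refine ⟨?_, f w, ?_⟩
  · rw [← Finset.coe_nonempty, hτ]
    exact (Finset.coe_nonempty.2 hσ).image _
  · rw [hτ]
    rintro _ ⟨x, hx, rfl⟩
    exact f.mem_nbhd (hw hx)

/-- The homomorphism `π₁(|N_r(G)|, x) → π₁(|N_r(H)|, f x)` induced by a graph map `f`. -/
def mapFundamentalGroup (f : Hom G H) (r : ℕ) (x : V) (hx : (G.nbrs x).Nonempty) :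
    FundamentalGroup (G.nbhdComplex r).Realization (G.basePt r x hx) →*
      FundamentalGroup (H.nbhdComplex r).Realization (H.basePt r (f x) (f.nbrs_nonempty hx)) :=
  FundamentalGroup.mapOfEq
    (PreAbstractSimplicialComplex.realizationMap (f.isSimplicialMap r))
    (PreAbstractSimplicialComplex.realizationMap_vertexPt (f.isSimplicialMap r) x
      (G.singleton_mem_nbhdComplex r hx)
      (H.singleton_mem_nbhdComplex r (f.nbrs_nonempty hx)))

end Hom

/-! ### Paths in graphs and the `s`-fundamental group -/

/-- Paths from `x` to `y` in `G`. A path of length `n` amounts to a graph map into `G` from the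
graph with vertices `0, …, n` and edges `{i, i + 1}`; see `Walk.vert`. -/
inductive Walk (G : SymGraph V) : V → V → Type u
  | nil (x : V) : Walk G x x
  | cons {x y z : V} (h : G.Adj x y) (p : Walk G y z) : Walk G x z

namespace Walk

variable {G : SymGraph V} {H : SymGraph W}

/-- The length of a path. -/
def length : ∀ {x y : V}, Walk G x y → ℕ
  | _, _, nil _ => 0
  | _, _, cons _ p => p.length + 1

/-- The `i`-th vertex of a path, for `0 ≤ i ≤ length` (constant from there on). -/
def vert : ∀ {x y : V}, Walk G x y → ℕ → V
  | _, _, nil x, _ => x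
  | x, _, cons _ _, 0 => x
  | _, _, cons _ p, i + 1 => p.vert i

/-- Concatenation: first `p`, then `q`. -/
def append : ∀ {x y z : V}, Walk G x y → Walk G y z → Walk G x z
  | _, _, _, nil _, q => q
  | _, _, _, cons h p, q => cons h (p.append q)

/-- The path run backwards. -/
def reverse : ∀ {x y : V}, Walk G x y → Walk G y x
  | _, _, nil x => nil x
  | x, _, cons h p => p.reverse.append (cons (G.symm h) (nil x))

/-- The image of a path under a graph map. -/
def map (f : Hom G H) : ∀ {x y : V}, Walk G x y → Walk H (f x) (f y)
  | _, _, nil x => nil (f x)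
  | _, _, cons h p => cons (f.map_adj h) (p.map f)

variable {x y z w : V}

@[simp] theorem vert_zero (p : Walk G x y) : p.vert 0 = x := by cases p <;> rfl

@[simp] theorem vert_length (p : Walk G x y) : p.vert p.length = y := by
  induction p with
  | nil => rfl
  | cons h p ih => exact ih

/-- Consecutive vertices of a path are adjacent. -/
theorem adj_vert (p : Walk G x y) : ∀ i < p.length, G.Adj (p.vert i) (p.vert (i + 1)) := by
  induction p with
  | nil => intro i hi; exact absurd hi (Nat.not_lt_zero i)
  | cons h p ih =>
    rintro (_ | i) hi
    · simpa [vert] using h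
    · exact ih i (Nat.lt_of_succ_lt_succ hi)

/-- Every graph map from `0 - 1 - ⋯ - n` to `G` is a path in a unique way. -/
theorem existsUnique_of_adj (n : ℕ) (φ : ℕ → V) (h : ∀ i < n, G.Adj (φ i) (φ (i + 1))) :
    ∃! p : Walk G (φ 0) (φ n), p.length = n ∧ ∀ i ≤ n, p.vert i = φ i := by
  have hex : ∀ (n : ℕ) (φ : ℕ → V), (∀ i < n, G.Adj (φ i) (φ (i + 1))) →
      ∃ p : Walk G (φ 0) (φ n), p.length = n ∧ ∀ i ≤ n, p.vert i = φ i := by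
    intro n
    induction n with
    | zero => exact fun φ _ => ⟨nil _, rfl, fun i hi => by rw [Nat.le_zero.1 hi]; rfl⟩
    | succ n ih =>
      intro φ h
      obtain ⟨p, hp, hv⟩ := ih (fun i => φ (i + 1)) fun i hi => h (i + 1) (by omega)
      refine ⟨cons (h 0 (by omega)) p, by simp [length, hp], ?_⟩
      rintro (_ | i) hi
      · rfl
      · exact hv i (by omega)
  have huniq : ∀ {a b : V} (p q : Walk G a b), p.length = q.length →
      (∀ i ≤ p.length, p.vert i = q.vert i) → p = q := by
    intro a b p
    induction p with
    | nil => intro q hl _; cases q with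
      | nil => rfl
      | cons h q => simp [length] at hl
    | cons h p ih => intro q hl hv; cases q with
      | nil => simp [length] at hl
      | cons h' q =>
        have h1 := hv 1 (by simp [length])
        simp only [vert, vert_zero] at h1
        subst h1
        rw [ih q (by simpa [length] using hl) fun i hi => hv (i + 1) (by simpa [length] using hi)]
  obtain ⟨p, hp, hv⟩ := hex n φ h
  refine ⟨p, ⟨hp, hv⟩, fun q hq => huniq _ _ (hq.1.trans hp.symm) fun i hi => ?_⟩
  rw [hq.1] at hi
  rw [hq.2 i hi, hv i hi]

@[simp] theorem nil_append (q : Walk G x y) : (nil x).append q = q := rfl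

@[simp] theorem append_nil (p : Walk G x y) : p.append (nil y) = p := by
  induction p with
  | nil => rfl
  | cons h p ih => simp only [append, ih]

theorem append_assoc (p : Walk G x y) (q : Walk G y z) (t : Walk G z w) :
    (p.append q).append t = p.append (q.append t) := by
  induction p with
  | nil => rfl
  | cons h p ih => simp only [append, ih]

@[simp] theorem length_append (p : Walk G x y) (q : Walk G y z) :
    (p.append q).length = p.length + q.length := by
  induction p with
  | nil => simp [append, length]
  | cons h p ih => simp only [append, length, ih]; omega

theorem vert_append_left (p : Walk G x y) (q : Walk G y z) :
    ∀ i ≤ p.length, (p.append q).vert i = p.vert i := by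
  induction p with
  | nil => intro i hi; rw [Nat.le_zero.1 hi]; simp
  | cons h p ih =>
    rintro (_ | i) hi
    · rfl
    · exact ih q i (Nat.le_of_succ_le_succ hi)

theorem vert_append_right (p : Walk G x y) (q : Walk G y z) (i : ℕ) :
    (p.append q).vert (p.length + i) = q.vert i := by
  induction p with
  | nil => simp [append, length]
  | cons h p ih =>
    rw [show (cons h p).length + i = (p.length + i) + 1 by simp only [length]; omega]
    exact ih q

@[simp] theorem length_reverse (p : Walk G x y) : p.reverse.length = p.length := by
  induction p with
  | nil => rfl
  | cons h p ih => simp [reverse, length, ih]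

theorem vert_reverse (p : Walk G x y) :
    ∀ i ≤ p.length, p.reverse.vert i = p.vert (p.length - i) := by
  induction p with
  | nil => intro i _; rfl
  | cons h p ih =>
    intro i hi
    rcases Nat.lt_or_ge p.length i with hlt | hle
    · obtain rfl : i = p.length + 1 := le_antisymm hi hlt
      have := vert_append_right p.reverse (cons (G.symm h) (nil _)) 1
      rw [length_reverse] at this
      simpa [reverse, length, vert] using this
    · rw [reverse, vert_append_left _ _ _ (by simpa using hle), ih i hle,
        show (cons h p).length - i = (p.length - i) + 1 by simp only [length]; omega]
      rfl

@[simp] theorem length_map (f : Hom G H) (p : Walk G x y) : (p.map f).length = p.length := by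
  induction p with
  | nil => rfl
  | cons h p ih => simp only [map, length, ih]

theorem vert_map (f : Hom G H) (p : Walk G x y) : ∀ i, (p.map f).vert i = f (p.vert i) := by
  induction p with
  | nil => intro i; rfl
  | cons h p ih =>
    rintro (_ | i)
    · rfl
    · exact ih i

theorem map_append (f : Hom G H) (p : Walk G x y) (q : Walk G y z) :
    (p.append q).map f = (p.map f).append (q.map f) := by
  induction p with
  | nil => rfl
  | cons h p ih => simp only [append, map, ih]

/-- An elementary `s`-homotopy from `φ` to `ψ` (paths with the same ends): either `ψ` arises from
`φ` by inserting a backtracking of length `2` at some place `k`, or `φ` and `ψ` have the same length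
and differ at most at `s - 1` consecutive places `k, k + 1, …, k + s - 2`. -/
inductive Step (s : ℕ) (φ ψ : Walk G x y) : Prop
  | backtrack (k : ℕ) (hk : k ≤ φ.length) (hlen : ψ.length = φ.length + 2)
      (hle : ∀ i ≤ k, φ.vert i = ψ.vert i)
      (hge : ∀ i, k ≤ i → i ≤ φ.length → φ.vert i = ψ.vert (i + 2))
  | replace (k : ℕ) (hlen : ψ.length = φ.length)
      (heq : ∀ i ≤ φ.length, (i < k ∨ k + s ≤ i + 1) → φ.vert i = ψ.vert i)

/-- The `s`-homotopy of paths: the equivalence relation generated by the elementary ones. -/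
def Homotopic (s : ℕ) (φ ψ : Walk G x y) : Prop := Relation.EqvGen (Step s) φ ψ

theorem Homotopic.refl {s : ℕ} (φ : Walk G x y) : Homotopic s φ φ :=
  Relation.EqvGen.refl φ

theorem Homotopic.symm {s : ℕ} {φ ψ : Walk G x y} (h : Homotopic s φ ψ) : Homotopic s ψ φ :=
  Relation.EqvGen.symm _ _ h

theorem Homotopic.trans {s : ℕ} {φ ψ χ : Walk G x y} (h : Homotopic s φ ψ)
    (h' : Homotopic s ψ χ) : Homotopic s φ χ :=
  Relation.EqvGen.trans _ _ _ h h'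

theorem Homotopic.lift {s : ℕ} {a b : W} {F : Walk G x y → Walk H a b}
    (hF : ∀ φ ψ, Step s φ ψ → Step s (F φ) (F ψ)) {φ ψ : Walk G x y} (h : Homotopic s φ ψ) :
    Homotopic s (F φ) (F ψ) := by
  induction h with
  | rel _ _ h => exact .rel _ _ (hF _ _ h)
  | refl _ => exact .refl _
  | symm _ _ _ ih => exact ih.symm
  | trans _ _ _ _ _ ih ih' => exact ih.trans ih'

theorem Step.append_right {s : ℕ} {φ ψ : Walk G x y} (h : Step s φ ψ) (q : Walk G y z) :
    Step s (φ.append q) (ψ.append q) := by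
  cases h with
  | backtrack k hk hlen hle hge =>
    refine .backtrack k (by simp; omega) (by simp; omega) (fun i hi => ?_) fun i hi hi' => ?_
    · rw [vert_append_left _ _ _ (by omega), vert_append_left _ _ _ (by omega), hle i hi]
    · rcases Nat.le_total i φ.length with h | h
      · rw [vert_append_left _ _ _ h, vert_append_left _ _ _ (by omega), hge i hi h]
      · obtain ⟨j, rfl⟩ := Nat.exists_eq_add_of_le h
        rw [vert_append_right, show φ.length + j + 2 = ψ.length + j by omega, vert_append_right]
  | replace k hlen heq =>
    refine .replace k (by simp; omega) fun i hi hk => ?_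
    rcases Nat.le_total i φ.length with h | h
    · rw [vert_append_left _ _ _ h, vert_append_left _ _ _ (by omega), heq i h hk]
    · obtain ⟨j, rfl⟩ := Nat.exists_eq_add_of_le h
      rw [vert_append_right, ← hlen, vert_append_right]

theorem Step.append_left {s : ℕ} {φ ψ : Walk G y z} (p : Walk G x y) (h : Step s φ ψ) :
    Step s (p.append φ) (p.append ψ) := by
  cases h with
  | backtrack k hk hlen hle hge =>
    refine .backtrack (p.length + k) (by simp; omega) (by simp; omega) (fun i hi => ?_)
      fun i hi hi' => ?_
    · rcases Nat.le_total i p.length with h | h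
      · rw [vert_append_left _ _ _ h, vert_append_left _ _ _ h]
      · obtain ⟨j, rfl⟩ := Nat.exists_eq_add_of_le h
        rw [vert_append_right, vert_append_right, hle j (by omega)]
    · obtain ⟨j, rfl⟩ := Nat.exists_eq_add_of_le (show p.length ≤ i by omega)
      rw [length_append] at hi'
      rw [vert_append_right, add_assoc, vert_append_right, hge j (by omega) (by omega)]
  | replace k hlen heq =>
    refine .replace (p.length + k) (by simp; omega) fun i hi hk => ?_
    rcases Nat.le_total i p.length with h | h
    · rw [vert_append_left _ _ _ h, vert_append_left _ _ _ h]
    · obtain ⟨j, rfl⟩ := Nat.exists_eq_add_of_le h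
      rw [length_append] at hi
      rw [vert_append_right, vert_append_right, heq j (by omega) (by omega)]

theorem Step.map {s : ℕ} (f : Hom G H) {φ ψ : Walk G x y} (h : Step s φ ψ) :
    Step s (φ.map f) (ψ.map f) := by
  cases h with
  | backtrack k hk hlen hle hge =>
    refine .backtrack k (by simpa using hk) (by simpa using hlen) (fun i hi => ?_)
      fun i hi hi' => ?_
    · rw [vert_map, vert_map, hle i hi]
    · rw [vert_map, vert_map, hge i hi (by simpa using hi')]
  | replace k hlen heq =>
    refine .replace k (by simpa using hlen) fun i hi hk => ?_
    rw [vert_map, vert_map, heq i (by simpa using hi) hk]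

theorem Homotopic.append {s : ℕ} {φ φ' : Walk G x y} {ψ ψ' : Walk G y z}
    (h : Homotopic s φ φ') (h' : Homotopic s ψ ψ') :
    Homotopic s (φ.append ψ) (φ'.append ψ') :=
  (h.lift (F := fun p => p.append ψ) fun _ _ h => h.append_right ψ).trans
    (h'.lift (F := fun q => φ'.append q) fun _ _ h => h.append_left φ')

theorem Homotopic.map {s : ℕ} (f : Hom G H) {φ ψ : Walk G x y} (h : Homotopic s φ ψ) :
    Homotopic s (φ.map f) (ψ.map f) :=
  h.lift fun _ _ h => h.map f

theorem reverse_append (p : Walk G x y) (q : Walk G y z) :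
    (p.append q).reverse = q.reverse.append p.reverse := by
  induction p with
  | nil => simp [reverse]
  | cons h p ih => simp only [append, reverse, ih, append_assoc]

theorem reverse_reverse (p : Walk G x y) : p.reverse.reverse = p := by
  induction p with
  | nil => rfl
  | cons h p ih => rw [reverse, reverse_append, ih]; rfl

theorem append_reverse_homotopic (s : ℕ) (p : Walk G x y) :
    Homotopic s (p.append p.reverse) (nil x) := by
  induction p with
  | nil => exact .refl _
  | @cons a b c h p ih =>
    have h1 : Homotopic s ((cons h p).append (cons h p).reverse)
        (((cons h (nil b)).append (nil b)).append (cons (G.symm h) (nil a))) := by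
      have := (((Homotopic.refl (cons h (nil b))).append ih).append
        (Homotopic.refl (s := s) (cons (G.symm h) (nil a))))
      simpa [append, reverse, append_assoc] using this
    refine h1.trans (Homotopic.symm (.rel _ _ (.backtrack 0 (by simp) rfl ?_ ?_)))
    · intro i hi; rw [Nat.le_zero.1 hi]; rfl
    · intro i _ hi; rw [Nat.le_zero.1 hi]; rfl

theorem Step.reverse {s : ℕ} {φ ψ : Walk G x y} (h : Step s φ ψ) :
    Homotopic s φ.reverse ψ.reverse := by
  have h1 : Homotopic s (φ.reverse.append (ψ.append ψ.reverse)) (φ.reverse.append (nil x)) :=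
    (Homotopic.refl _).append (append_reverse_homotopic s ψ)
  have h2 : Homotopic s ((φ.reverse.append φ).append ψ.reverse)
      ((φ.reverse.append ψ).append ψ.reverse) :=
    ((Homotopic.refl _).append (.rel _ _ h)).append (.refl _)
  have h3 : Homotopic s ((φ.reverse.append φ).append ψ.reverse) ((nil y).append ψ.reverse) := by
    refine Homotopic.append ?_ (.refl _)
    simpa [reverse_reverse] using append_reverse_homotopic s φ.reverse
  rw [append_nil] at h1
  rw [append_assoc φ.reverse ψ] at h2
  exact (h3.symm.trans (h2.trans h1)).symm

theorem Homotopic.reverse {s : ℕ} {φ ψ : Walk G x y} (h : Homotopic s φ ψ) :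
    Homotopic s φ.reverse ψ.reverse := by
  induction h with
  | rel _ _ h => exact h.reverse
  | refl _ => exact .refl _
  | symm _ _ _ ih => exact ih.symm
  | trans _ _ _ _ _ ih ih' => exact ih.trans ih'

theorem reverse_append_homotopic (s : ℕ) (p : Walk G x y) :
    Homotopic s (p.reverse.append p) (nil y) := by
  simpa [reverse_reverse] using append_reverse_homotopic s p.reverse

/-- The equivalence relation of `s`-homotopy on the loops at `x`. -/
def loopSetoid (G : SymGraph V) (s : ℕ) (x : V) : Setoid (Walk G x x) where
  r := Homotopic s
  iseqv := ⟨.refl, .symm, .trans⟩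

end Walk

/-- The `s`-fundamental group `π₁^s(G, x)`: the loops at `x` up to `s`-homotopy. -/
def PiOne (G : SymGraph V) (s : ℕ) (x : V) : Type u := Quotient (Walk.loopSetoid G s x)

namespace PiOne

variable {G : SymGraph V} {H : SymGraph W} {s : ℕ} {x : V}

/-- The class of a loop. -/
def mk (s : ℕ) (p : Walk G x x) : PiOne G s x := Quotient.mk (Walk.loopSetoid G s x) p

/-- The product `[q] * [p]` is the class of the loop "first `p`, then `q`" (which is also the
convention of `FundamentalGroup`). -/
instance : Group (PiOne G s x) where
  mul a b := Quotient.liftOn₂ a b (fun q p => mk s (p.append q))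
    fun _ _ _ _ h h' => Quotient.sound (Walk.Homotopic.append h' h)
  one := mk s (.nil x)
  inv a := Quotient.liftOn a (fun p => mk s p.reverse)
    fun _ _ h => Quotient.sound (Walk.Homotopic.reverse h)
  mul_assoc := by
    rintro ⟨a⟩ ⟨b⟩ ⟨c⟩
    exact congrArg (mk s) (Walk.append_assoc c b a).symm
  one_mul := by
    rintro ⟨a⟩
    exact congrArg (mk s) (Walk.append_nil a)
  mul_one := by
    rintro ⟨a⟩
    rfl
  inv_mul_cancel := by
    rintro ⟨a⟩
    exact Quotient.sound (Walk.append_reverse_homotopic s a)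

theorem mk_mul_mk (p q : Walk G x x) : mk s q * mk s p = mk s (p.append q) := rfl

/-- The homomorphism `π₁^s(G, x) → π₁^s(H, f x)` induced by a graph map `f`. -/
def map (f : Hom G H) (s : ℕ) (x : V) : PiOne G s x →* PiOne H s (f x) where
  toFun a := Quotient.liftOn a (fun p => mk s (p.map f))
    fun _ _ h => Quotient.sound (Walk.Homotopic.map f h)
  map_one' := rfl
  map_mul' := by
    rintro ⟨a⟩ ⟨b⟩
    exact congrArg (mk s) (Walk.map_append f b a)

end PiOne

/-- The even part `π₁^s(G, x)_ev`: the classes of the loops of even length. -/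
def evenPart (G : SymGraph V) (s : ℕ) (x : V) : Subgroup (PiOne G s x) where
  carrier := {a | ∃ p : Walk G x x, Even p.length ∧ PiOne.mk s p = a}
  mul_mem' := by
    rintro _ _ ⟨q, hq, rfl⟩ ⟨p, hp, rfl⟩
    exact ⟨p.append q, by simpa using hp.add hq, rfl⟩
  one_mem' := ⟨.nil x, by simp [Walk.length], rfl⟩
  inv_mem' := by
    rintro _ ⟨p, hp, rfl⟩
    exact ⟨p.reverse, by simpa using hp, rfl⟩

/-- The homomorphism `π₁^s(G, x)_ev → π₁^s(H, f x)_ev` induced by a graph map `f`. -/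
def Hom.mapEvenPart {G : SymGraph V} {H : SymGraph W} (f : Hom G H) (s : ℕ) (x : V) :
    G.evenPart s x →* H.evenPart s (f x) :=
  ((PiOne.map f s x).comp (G.evenPart s x).subtype).codRestrict (H.evenPart s (f x)) (by
    rintro ⟨_, p, hp, rfl⟩
    exact ⟨p.map f, by simpa using hp, rfl⟩)

end SymGraph

end

/-!
# The fundamental group of a neighborhood complex and the even part of `π₁^{2r}`

The isomorphism is built as the inverse of a homomorphism `π₁^{2r}(G, v)_ev → π₁(|N_r(G)|, v)`,
`SymGraph.evenToFundamentalGroup`, which sends a walk `x₀, x₁, …, x₂ₙ` to the edge path `x₀, x₂, …,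
x₂ₙ`. Both sides are handled by means of cocycles: functions `E` on the edges of the complex with
values in a group that are multiplicative on triangles. The product of the values of `E` along the
vertices of even index is an invariant of walks.

*Invariance under `2r`-homotopy* (`SymGraph.IsCocycle.altProd_eq_of_homotopic`). In a walk of
length `2r` the vertices of even index lie in the `r`-neighborhood of the midpoint, so that the
value of the walk depends on its ends only. The vertices of odd index of a closed walk of length
`4r` are treated by rotating it by one edge. In order to speak of both colorings at once, `altProd`
replaces the vertices of the other color by neighbors.

*Topology.* The open stars of the vertices form a cover of `|N_r(G)|` by contractible open sets
whose pairwise intersections are empty or path connected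
(`PreAbstractSimplicialComplex.starCover`). For such a `GoodCover` every path between vertices is
homotopic to an edge path (`GoodCover.edge_induction`), which gives surjectivity. A cocycle on the
cover defines a covering space in which the transport along an edge is multiplication by the
cocycle (`GoodCover.transport_edge`).

*Injectivity.* There is a tautological cocycle, `SymGraph.walkCocycle`: an edge of `N_r(G)` goes to
the class of the walks of length `2r` between its ends. Transport along the edge path of a closed
walk of even length in the covering of this cocycle multiplies by the class of the walk; hence the
class is trivial if the edge path is null-homotopic.

Cocycles with values in groups, rather than groupoids, are obtained through the retraction
`CategoryTheory.Groupoid.retract` of a groupoid onto a vertex group. Naturality holds because a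
graph map sends edge paths to edge paths.
-/

noncomputable section

open CategoryTheory Topology

/-! ### Retracting a groupoid onto a vertex group -/

namespace CategoryTheory.Groupoid

variable {C : Type*} [Groupoid C] (b : C)

/-- For every object `x` of the component of `b`, a morphism `b ⟶ x`; it is the identity
for `x = b`. -/
def spoke {x : C} (h : Nonempty (b ⟶ x)) : b ⟶ x :=
  Groupoid.inv (Classical.choice ⟨𝟙 b⟩) ≫ Classical.choice h

theorem spoke_self (h : Nonempty (b ⟶ b)) : spoke b h = 𝟙 b := by
  simp [spoke]

open Classical in
/-- The retraction of a groupoid onto the vertex group at `b`: the spokes close a morphism of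
the component of `b` up to a loop, and the morphisms of the other components go to `1`. -/
def retract {x y : C} (f : x ⟶ y) : End b :=
  if h : Nonempty (b ⟶ x) then
    End.of (spoke b h ≫ f ≫ Groupoid.inv (spoke b (h.map (· ≫ f))))
  else 1

theorem retract_of_nonempty {x y : C} (f : x ⟶ y) (h : Nonempty (b ⟶ x))
    (h' : Nonempty (b ⟶ y)) :
    retract b f = End.of (spoke b h ≫ f ≫ Groupoid.inv (spoke b h')) :=
  dif_pos h

theorem retract_comp {x y z : C} (f : x ⟶ y) (g : y ⟶ z) :
    retract b (f ≫ g) = retract b g * retract b f := by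
  by_cases h : Nonempty (b ⟶ x)
  · have hy : Nonempty (b ⟶ y) := h.map (· ≫ f)
    have hz : Nonempty (b ⟶ z) := hy.map (· ≫ g)
    rw [retract_of_nonempty b _ h hz, retract_of_nonempty b _ h hy,
      retract_of_nonempty b _ hy hz, End.mul_def]
    simp [End.of]
  · have hy : ¬ Nonempty (b ⟶ y) := fun k => h (k.map (· ≫ Groupoid.inv f))
    rw [retract, retract, retract, dif_neg h, dif_neg h, dif_neg hy, one_mul]

theorem retract_loop (f : b ⟶ b) : retract b f = End.of f := by
  rw [retract_of_nonempty b f ⟨𝟙 b⟩ ⟨𝟙 b⟩, spoke_self]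
  simp

theorem retract_id (x : C) : retract b (𝟙 x) = 1 := by
  have h := retract_comp b (𝟙 x) (𝟙 x)
  rw [Category.comp_id] at h
  exact (mul_eq_right.1 h.symm)

end CategoryTheory.Groupoid

/-! ### Open covers that compute the fundamental groupoid -/

/-- An open cover of `X` by sets `U i` with base points such that each `U i` is path connected,
any two paths of `U i` with the same ends are homotopic in `X`, and the sets `U i ∩ U j` are
empty or path connected. -/
structure GoodCover (X : Type*) [TopologicalSpace X] (ι : Type*) where
  /-- the members of the cover -/
  U : ι → Set X
  /-- the base points -/
  pt : ι → X
  isOpen : ∀ i, IsOpen (U i)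
  exists_mem : ∀ a, ∃ i, a ∈ U i
  pt_mem : ∀ i, pt i ∈ U i
  joined : ∀ i, ∀ a ∈ U i, JoinedIn (U i) (pt i) a
  homotopic : ∀ i {a b : X} (γ γ' : Path a b), (∀ t, γ t ∈ U i) → (∀ t, γ' t ∈ U i) →
    γ.Homotopic γ'
  joined_inter : ∀ i j a b, a ∈ U i → a ∈ U j → b ∈ U i → b ∈ U j → JoinedIn (U i ∩ U j) a b

namespace GoodCover

variable {X ι : Type*} [TopologicalSpace X] (c : GoodCover X ι)

/-- The class of a path as a morphism of the fundamental groupoid. -/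
def homMk {a b : X} (γ : Path a b) : FundamentalGroupoid.mk a ⟶ FundamentalGroupoid.mk b :=
  Path.Homotopic.Quotient.mk γ

theorem homMk_surjective {a b : X} (q : FundamentalGroupoid.mk a ⟶ FundamentalGroupoid.mk b) :
    ∃ γ : Path a b, homMk γ = q :=
  Path.Homotopic.Quotient.mk_surjective q

theorem homMk_trans {a b d : X} (γ : Path a b) (δ : Path b d) :
    homMk (γ.trans δ) = homMk γ ≫ homMk δ := rfl

theorem homMk_refl (a : X) : homMk (Path.refl a) = 𝟙 _ := rfl

theorem homMk_eq {a b : X} {γ δ : Path a b} (h : γ.Homotopic δ) : homMk γ = homMk δ :=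
  Path.Homotopic.Quotient.eq.2 h

theorem homMk_cast {a b a' b' : X} (γ : Path a b) (ha : a' = a) (hb : b' = b) :
    homMk ((Path.refl a).cast rfl ha) ≫ homMk (γ.cast ha hb) ≫
      Groupoid.inv (homMk ((Path.refl b).cast rfl hb)) = homMk γ := by
  subst ha hb
  simp [homMk_refl]

/-- The unique class of paths from the base point of `U i` to `a` inside `U i`. -/
def ray (i : ι) (a : X) (ha : a ∈ c.U i) :
    FundamentalGroupoid.mk (c.pt i) ⟶ FundamentalGroupoid.mk a :=
  homMk (c.joined i a ha).somePath

theorem ray_eq (i : ι) {a : X} (γ : Path (c.pt i) a) (hγ : ∀ t, γ t ∈ c.U i) (ha : a ∈ c.U i) :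
    c.ray i a ha = homMk γ :=
  homMk_eq (c.homotopic i _ _ (c.joined i a ha).somePath_mem hγ)

theorem ray_comp (i : ι) {a b : X} (γ : Path a b) (hγ : ∀ t, γ t ∈ c.U i) (ha : a ∈ c.U i)
    (hb : b ∈ c.U i) : c.ray i a ha ≫ homMk γ = c.ray i b hb := by
  rw [ray, ← homMk_trans]
  refine (c.ray_eq i _ (fun t => ?_) hb).symm
  have : ((c.joined i a ha).somePath.trans γ) t ∈
      Set.range ((c.joined i a ha).somePath.trans γ) := ⟨t, rfl⟩
  rw [Path.trans_range] at this
  rcases this with ⟨s, hs⟩ | ⟨s, hs⟩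
  · rw [← hs]; exact (c.joined i a ha).somePath_mem s
  · rw [← hs]; exact hγ s

/-- The class of paths from `pt i` to `pt j` that run in `U i` to a point of `U i ∩ U j` and from
there in `U j`. -/
def edge (i j : ι) (h : ∃ a, a ∈ c.U i ∧ a ∈ c.U j) :
    FundamentalGroupoid.mk (c.pt i) ⟶ FundamentalGroupoid.mk (c.pt j) :=
  c.ray i h.choose h.choose_spec.1 ≫ Groupoid.inv (c.ray j h.choose h.choose_spec.2)

theorem edge_eq (i j : ι) (h : ∃ a, a ∈ c.U i ∧ a ∈ c.U j) (a : X) (hi : a ∈ c.U i)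
    (hj : a ∈ c.U j) : c.edge i j h = c.ray i a hi ≫ Groupoid.inv (c.ray j a hj) := by
  have hJ := c.joined_inter i j _ a h.choose_spec.1 h.choose_spec.2 hi hj
  rw [edge, ← c.ray_comp i hJ.somePath (fun t => (hJ.somePath_mem t).1) h.choose_spec.1 hi,
    ← c.ray_comp j hJ.somePath (fun t => (hJ.somePath_mem t).2) h.choose_spec.2 hj]
  simp

theorem edge_comp (i j k : ι) (hij : ∃ a, a ∈ c.U i ∧ a ∈ c.U j)
    (hjk : ∃ a, a ∈ c.U j ∧ a ∈ c.U k) (hik : ∃ a, a ∈ c.U i ∧ a ∈ c.U k)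
    (h : ∃ a, a ∈ c.U i ∧ a ∈ c.U j ∧ a ∈ c.U k) :
    c.edge i j hij ≫ c.edge j k hjk = c.edge i k hik := by
  obtain ⟨a, hi, hj, hk⟩ := h
  rw [c.edge_eq i j _ a hi hj, c.edge_eq j k _ a hj hk, c.edge_eq i k _ a hi hk]
  simp

/-- Every morphism of the fundamental groupoid between base points is a composition of edges:
cut the path into pieces that lie in members of the cover. -/
theorem edge_induction (i₀ : ι)
    (S : ∀ i, (FundamentalGroupoid.mk (c.pt i₀) ⟶ FundamentalGroupoid.mk (c.pt i)) → Prop)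
    (h_id : S i₀ (𝟙 _))
    (h_edge : ∀ i j q h, S i q → S j (q ≫ c.edge i j h)) (i : ι)
    (q : FundamentalGroupoid.mk (c.pt i₀) ⟶ FundamentalGroupoid.mk (c.pt i)) : S i q := by
  obtain ⟨γ, rfl⟩ := homMk_surjective q
  obtain ⟨t, ht0, hmono, ⟨n, hn⟩, hsub⟩ :=
    exists_monotone_Icc_subset_open_cover_unitInterval (c := fun i => γ ⁻¹' c.U i)
      (fun i => (c.isOpen i).preimage γ.continuous)
      (fun s _ => Set.mem_iUnion.2 (c.exists_mem (γ s)))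
  have h0 : γ 0 ∈ c.U i₀ := by rw [γ.source]; exact c.pt_mem i₀
  have h1 : γ 1 ∈ c.U i := by rw [γ.target]; exact c.pt_mem i
  -- an initial piece of `γ`, closed up by a ray, is a composition of edges
  have key : ∀ m j (hj : γ (t m) ∈ c.U j), S j (c.ray i₀ (γ 0) h0 ≫
      homMk (γ.subpath 0 (t m)) ≫ Groupoid.inv (c.ray j (γ (t m)) hj)) := by
    intro m
    induction m with
    | zero =>
      rw [ht0]
      intro j hj
      have h2 := h_edge i₀ j (𝟙 _) ⟨γ 0, h0, hj⟩ h_id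
      rw [c.edge_eq i₀ j _ (γ 0) h0 hj, Category.id_comp] at h2
      rw [Path.subpath_self, homMk_refl, Category.id_comp]
      exact h2
    | succ m ih =>
      intro j hj
      obtain ⟨k, hk⟩ := hsub m
      have hle : t m ≤ t (m + 1) := hmono (Nat.le_succ m)
      have hm : γ (t m) ∈ c.U k := hk ⟨le_rfl, hle⟩
      have hm' : γ (t (m + 1)) ∈ c.U k := hk ⟨hle, le_rfl⟩
      have hγ : ∀ s, γ.subpath (t m) (t (m + 1)) s ∈ c.U k := by
        intro s
        have : γ.subpath (t m) (t (m + 1)) s ∈ Set.range (γ.subpath (t m) (t (m + 1))) := ⟨s, rfl⟩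
        rw [Path.range_subpath_of_le _ _ _ hle] at this
        obtain ⟨s', hs', hs⟩ := this
        rw [← hs]; exact hk hs'
      have h2 := h_edge k j _ ⟨_, hm', hj⟩ (ih k hm)
      rw [c.edge_eq k j _ _ hm' hj, ← c.ray_comp k _ hγ hm] at h2
      have h3 : homMk (γ.subpath 0 (t (m + 1))) =
          homMk (γ.subpath 0 (t m)) ≫ homMk (γ.subpath (t m) (t (m + 1))) :=
        homMk_eq (Path.Homotopic.symm ⟨Path.Homotopy.subpathTransSubpath γ 0 (t m) (t (m + 1))⟩)
      rw [h3]
      simpa using h2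
  have h2 := key n
  rw [hn n le_rfl] at h2
  have h3 := h2 i h1
  rw [c.ray_eq i₀ ((Path.refl (c.pt i₀)).cast rfl γ.source) (fun _ => c.pt_mem i₀),
    c.ray_eq i ((Path.refl (c.pt i)).cast rfl γ.target) (fun _ => c.pt_mem i),
    Path.subpath_zero_one, homMk_cast] at h3
  exact h3

/-! ### The covering space of a cocycle -/

section Cocycle

variable {Γ : Type*} [Group Γ] [TopologicalSpace Γ] [DiscreteTopology Γ] (g : ι → ι → Γ)
  (hg : ∀ i j k a, a ∈ c.U i → a ∈ c.U j → a ∈ c.U k → g j k * g i j = g i k)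

/-- The principal bundle with discrete fiber `Γ` and transition functions `g`. -/
def bundle : FiberBundleCore ι X Γ where
  baseSet := c.U
  isOpen_baseSet := c.isOpen
  indexAt a := (c.exists_mem a).choose
  mem_baseSet_at a := (c.exists_mem a).choose_spec
  coordChange i j _ x := g i j * x
  coordChange_self i a ha x := by
    rw [mul_eq_right.1 (hg i i i a ha ha ha), one_mul]
  continuousOn_coordChange i j :=
    (continuous_of_discreteTopology (f := fun x => g i j * x)).comp continuous_snd |>.continuousOn
  coordChange_comp i j k a ha x := by
    rw [← mul_assoc, hg i j k a ha.1.1 ha.1.2 ha.2]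

theorem isCoveringMap_bundle : IsCoveringMap (c.bundle g hg).proj :=
  FiberBundle.isCoveringMap (F := Γ) (E := (c.bundle g hg).Fiber)

/-- The point of the fiber over `a` with coordinate `x` in the chart over `U i`. -/
def fiberPt (i : ι) (a : X) (x : Γ) : (c.bundle g hg).proj ⁻¹' {a} :=
  ⟨((c.bundle g hg).localTriv i).toOpenPartialHomeomorph.symm (a, x), rfl⟩

theorem fiberPt_change (i j : ι) (a : X) (hi : a ∈ c.U i) (hj : a ∈ c.U j) (x : Γ) :
    c.fiberPt g hg i a x = c.fiberPt g hg j a (g i j * x) := by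
  refine Subtype.ext (congrArg (Bundle.TotalSpace.mk a) ?_)
  exact ((c.bundle g hg).coordChange_comp i j _ a
    ⟨⟨hi, hj⟩, (c.bundle g hg).mem_baseSet_at a⟩ x).symm

theorem fiberPt_injective (i : ι) (a : X) (hi : a ∈ c.U i) :
    Function.Injective (c.fiberPt g hg i a) := by
  intro x y h
  have h1 := congrArg Subtype.val h
  have h2 := congrArg ((c.bundle g hg).localTriv i) h1
  have hx : ∀ z : Γ, (c.bundle g hg).localTriv i (c.fiberPt g hg i a z).1 = (a, z) := fun z =>
    ((c.bundle g hg).localTriv i).apply_symm_apply' hi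
  rw [hx, hx] at h2
  exact congrArg Prod.snd h2

/-- The transport along a morphism of the fundamental groupoid in the covering of a cocycle. -/
def transport {a b : X} (q : FundamentalGroupoid.mk a ⟶ FundamentalGroupoid.mk b) :
    (c.bundle g hg).proj ⁻¹' {a} → (c.bundle g hg).proj ⁻¹' {b} :=
  (c.isCoveringMap_bundle g hg).monodromy q

theorem transport_id (a : X) (e : (c.bundle g hg).proj ⁻¹' {a}) :
    c.transport g hg (𝟙 (FundamentalGroupoid.mk a)) e = e :=
  congrFun (c.isCoveringMap_bundle g hg).monodromy_refl e

theorem transport_comp {a b d : X} (q : FundamentalGroupoid.mk a ⟶ FundamentalGroupoid.mk b)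
    (q' : FundamentalGroupoid.mk b ⟶ FundamentalGroupoid.mk d)
    (e : (c.bundle g hg).proj ⁻¹' {a}) :
    c.transport g hg (q ≫ q') e = c.transport g hg q' (c.transport g hg q e) :=
  (c.isCoveringMap_bundle g hg).monodromy_trans_apply q q' e

theorem transport_homMk (i : ι) {a b : X} (γ : Path a b) (hγ : ∀ t, γ t ∈ c.U i) (x : Γ) :
    c.transport g hg (homMk γ) (c.fiberPt g hg i a x) =
      c.fiberPt g hg i b x := by
  let e := ((c.bundle g hg).localTriv i).toOpenPartialHomeomorph.symm
  have he : Continuous fun t => e (γ t, x) := by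
    refine ((c.bundle g hg).localTriv i).toOpenPartialHomeomorph.continuousOn_symm.comp_continuous
      (γ.continuous.prodMk continuous_const) fun t => ?_
    exact ⟨hγ t, trivial⟩
  let Γ' : Path (c.fiberPt g hg i a x).1 (c.fiberPt g hg i b x).1 :=
    ⟨⟨fun t => e (γ t, x), he⟩, by simp [fiberPt, e], by simp [fiberPt, e]⟩
  exact (c.isCoveringMap_bundle g hg).monodromy_eq_of_map_eq (Path.Homotopic.Quotient.mk Γ') rfl

theorem transport_ray (i : ι) (a : X) (ha : a ∈ c.U i) (x : Γ) :
    c.transport g hg (c.ray i a ha) (c.fiberPt g hg i (c.pt i) x) = c.fiberPt g hg i a x :=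
  c.transport_homMk g hg i _ (c.joined i a ha).somePath_mem x

theorem transport_inv_ray (i : ι) (a : X) (ha : a ∈ c.U i) (x : Γ) :
    c.transport g hg (Groupoid.inv (c.ray i a ha)) (c.fiberPt g hg i a x) =
      c.fiberPt g hg i (c.pt i) x :=
  c.transport_homMk g hg i (c.joined i a ha).somePath.symm
    (fun _ => (c.joined i a ha).somePath_mem _) x

/-- Along an edge the monodromy of the covering is given by the cocycle. -/
theorem transport_edge (i j : ι) (h : ∃ a, a ∈ c.U i ∧ a ∈ c.U j) (x : Γ) :
    c.transport g hg (c.edge i j h) (c.fiberPt g hg i (c.pt i) x) =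
      c.fiberPt g hg j (c.pt j) (g i j * x) := by
  obtain ⟨a, hi, hj⟩ := id h
  rw [c.edge_eq i j h a hi hj, transport_comp, transport_ray,
    c.fiberPt_change g hg i j a hi hj, transport_inv_ray]

end Cocycle

end GoodCover

namespace SymGraph

variable {V : Type u} {W : Type v} {G : SymGraph V}

/-! ### Walks and neighborhoods -/

theorem mem_nbhd_succ {r : ℕ} {w x y : V} (hx : x ∈ G.nbhd r w) (h : G.Adj x y) :
    y ∈ G.nbhd (r + 1) w :=
  Set.mem_biUnion hx h

theorem exists_nbrs_subset_nbhd {r : ℕ} (hr : 1 ≤ r) {x : V} (hx : (G.nbrs x).Nonempty) :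
    ∃ w, G.nbrs x ⊆ G.nbhd r w := by
  obtain ⟨w, hw⟩ := G.exists_mem_nbhd (r - 1) x hx
  refine ⟨w, fun y hy => ?_⟩
  rw [← Nat.sub_add_cancel hr]
  exact mem_nbhd_succ hw hy

theorem nbrs_nonempty_of_mem_nbhd {r : ℕ} (hr : 1 ≤ r) {w x : V} (hx : x ∈ G.nbhd r w) :
    (G.nbrs x).Nonempty := by
  obtain ⟨r, rfl⟩ := Nat.exists_eq_add_of_le' hr
  obtain ⟨y, -, hy⟩ := Set.mem_iUnion₂.1 hx
  exact ⟨y, G.symm hy⟩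

theorem mem_nbhd_add_two_mul {m : ℕ} {w x : V} (hx : (G.nbrs x).Nonempty) (h : x ∈ G.nbhd m w)
    (t : ℕ) : x ∈ G.nbhd (m + 2 * t) w := by
  induction t with
  | zero => exact h
  | succ t ih =>
    obtain ⟨y, hy⟩ := hx
    exact mem_nbhd_succ (mem_nbhd_succ ih hy) (G.symm hy)

namespace Walk

variable {x y z : V}

theorem ext_vert (p q : Walk G x y) (hl : p.length = q.length)
    (hv : ∀ i ≤ p.length, p.vert i = q.vert i) : p = q := by
  induction p with
  | nil => cases q with
    | nil => rfl
    | cons h q => simp [length] at hl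
  | cons h p ih => cases q with
    | nil => simp [length] at hl
    | cons h' q =>
      have h1 := hv 1 (by simp [length])
      simp only [vert, vert_zero] at h1
      subst h1
      rw [ih q (by simpa [length] using hl) fun i hi => hv (i + 1) (by simpa [length] using hi)]

theorem exists_append (p : Walk G x y) (k : ℕ) (hk : k ≤ p.length) :
    ∃ (z : V) (a : Walk G x z) (c : Walk G z y), a.length = k ∧ p = a.append c := by
  induction p generalizing k with
  | nil x => exact ⟨x, nil x, nil x, (Nat.le_zero.1 hk).symm, rfl⟩
  | @cons x w y h p ih =>
    cases k with
    | zero => exact ⟨x, nil x, cons h p, rfl, rfl⟩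
    | succ k =>
      obtain ⟨z, a, c, ha, rfl⟩ := ih k (Nat.le_of_succ_le_succ hk)
      exact ⟨z, cons h a, c, congrArg (· + 1) ha, rfl⟩

theorem exists_length_eq (hx : (G.nbrs x).Nonempty) (n : ℕ) :
    ∃ (y : V) (p : Walk G x y), p.length = n := by
  induction n generalizing x with
  | zero => exact ⟨x, nil x, rfl⟩
  | succ n ih =>
    obtain ⟨w, hw⟩ := hx
    obtain ⟨y, p, hp⟩ := ih (x := w) ⟨x, G.symm hw⟩
    exact ⟨y, cons hw p, congrArg (· + 1) hp⟩

theorem exists_of_mem_nbhd {m : ℕ} {w x : V} (h : x ∈ G.nbhd m w) :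
    ∃ p : Walk G w x, p.length = m := by
  induction m generalizing x with
  | zero => obtain rfl : x = w := h; exact ⟨nil x, rfl⟩
  | succ m ih =>
    obtain ⟨y, hy, hxy⟩ := Set.mem_iUnion₂.1 h
    obtain ⟨p, hp⟩ := ih hy
    exact ⟨p.append (cons hxy (nil x)), by simp [length, hp]⟩

theorem vert_add_mem_nbhd (p : Walk G x y) (i t : ℕ) (h : i + t ≤ p.length) :
    p.vert (i + t) ∈ G.nbhd t (p.vert i) := by
  induction t with
  | zero => rfl
  | succ t ih => exact mem_nbhd_succ (ih (by omega)) (p.adj_vert (i + t) (by omega))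

theorem vert_mem_nbhd_add (p : Walk G x y) (i t : ℕ) (h : i + t ≤ p.length) :
    p.vert i ∈ G.nbhd t (p.vert (i + t)) := by
  induction t generalizing i with
  | zero => rfl
  | succ t ih =>
    have := ih (i + 1) (by omega)
    rw [show i + 1 + t = i + (t + 1) by omega] at this
    exact mem_nbhd_succ this (G.symm (p.adj_vert i (by omega)))

theorem nbrs_vert_nonempty (p : Walk G x y) (hp : 1 ≤ p.length) (i : ℕ) (hi : i ≤ p.length) :
    (G.nbrs (p.vert i)).Nonempty := by
  rcases Nat.lt_or_ge i p.length with h | h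
  · exact ⟨_, p.adj_vert i h⟩
  · obtain rfl : i = p.length := le_antisymm hi h
    have := p.adj_vert (p.length - 1) (by omega)
    rw [Nat.sub_add_cancel hp] at this
    exact ⟨_, G.symm this⟩

theorem nbrs_end_nonempty (p : Walk G x y) (hx : (G.nbrs x).Nonempty) :
    (G.nbrs y).Nonempty := by
  induction p with
  | nil => exact hx
  | cons h p ih => exact ih ⟨_, G.symm h⟩

/-- The vertices of even index of a walk of length `2 * r` lie in the `r`-neighborhood of its
midpoint. -/
theorem vert_even_mem_nbhd {r : ℕ} (hr : 1 ≤ r) (p : Walk G x y) (hp : p.length = 2 * r) (i : ℕ)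
    (hi : 2 * i ≤ 2 * r) : p.vert (2 * i) ∈ G.nbhd r (p.vert r) := by
  have hne := p.nbrs_vert_nonempty (by omega) (2 * i) (by omega)
  rcases Nat.le_total (2 * i) r with h | h
  · have h1 := p.vert_mem_nbhd_add (2 * i) (r - 2 * i) (by omega)
    rw [show 2 * i + (r - 2 * i) = r by omega] at h1
    have h2 := mem_nbhd_add_two_mul hne h1 i
    rwa [show r - 2 * i + 2 * i = r by omega] at h2
  · have h1 := p.vert_add_mem_nbhd r (2 * i - r) (by omega)
    rw [show r + (2 * i - r) = 2 * i by omega] at h1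
    have h2 := mem_nbhd_add_two_mul hne h1 (r - i)
    rwa [show 2 * i - r + 2 * (r - i) = r by omega] at h2

/-- Induction on walks of even length, two edges at a time. -/
theorem even_induction {motive : ∀ {x y : V}, Walk G x y → Prop} (nil : ∀ x, motive (nil x))
    (cons_cons : ∀ {x w z y : V} (h : G.Adj x w) (h' : G.Adj w z) (p : Walk G z y),
      Even p.length → motive p → motive (cons h (cons h' p))) :
    ∀ {x y : V} (p : Walk G x y), Even p.length → motive p
  | _, _, .nil x, _ => nil x
  | _, _, .cons h (.nil _), hp => by simp [length] at hp
  | _, _, .cons h (.cons h' p), hp => by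
    have hp' : Even p.length := by
      simp only [length] at hp
      have : p.length + 1 + 1 = p.length + 2 := rfl
      rw [this] at hp
      simpa [Nat.even_add] using hp
    exact cons_cons h h' p hp' (even_induction nil cons_cons p hp')

/-! ### Homotopy of walks -/

/-- Two walks of length at most `s` with the same length and the same ends are `s`-homotopic. -/
theorem homotopic_of_length_le {s : ℕ} (p q : Walk G x y) (hl : q.length = p.length)
    (hp : p.length ≤ s) : Homotopic s p q := by
  refine .rel _ _ (.replace 1 hl fun i hi h => ?_)
  rcases h with h | h
  · obtain rfl : i = 0 := by omega
    rw [vert_zero, vert_zero]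
  · obtain rfl : i = p.length := by omega
    rw [vert_length, ← hl, vert_length]

theorem exists_homotopic_length_add {s : ℕ} (p : Walk G x y) (hy : (G.nbrs y).Nonempty) (t : ℕ) :
    ∃ q : Walk G x y, q.length = p.length + 2 * t ∧ Homotopic s q p := by
  obtain ⟨w, hw⟩ := hy
  induction t with
  | zero => exact ⟨p, rfl, .refl p⟩
  | succ t ih =>
    obtain ⟨q, hq, hqp⟩ := ih
    refine ⟨q.append ((cons hw (nil w)).append (cons hw (nil w)).reverse), ?_, ?_⟩
    · simp [length, hq]; omega
    · have := hqp.append (append_reverse_homotopic s (cons hw (nil w)))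
      rwa [append_nil] at this

/-- The equivalence relation of `s`-homotopy on the walks from `x` to `y`. -/
def setoid (G : SymGraph V) (s : ℕ) (x y : V) : Setoid (Walk G x y) where
  r := Homotopic s
  iseqv := ⟨.refl, .symm, .trans⟩

end Walk

/-- The objects of the groupoid of walks modulo `s`-homotopy: the vertices of `G`. Its group at `x`
is `π₁^s(G, x)`. -/
structure WalkGroupoid (G : SymGraph V) (s : ℕ) : Type u where
  /-- the vertex -/
  as : V

instance (G : SymGraph V) (s : ℕ) : Groupoid (WalkGroupoid G s) where
  Hom x y := Quotient (Walk.setoid G s x.as y.as)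
  id x := Quotient.mk _ (.nil x.as)
  comp a b := Quotient.liftOn₂ a b (fun p q => Quotient.mk _ (p.append q))
    fun _ _ _ _ h h' => Quotient.sound (Walk.Homotopic.append h h')
  inv a := Quotient.liftOn a (fun p => Quotient.mk _ p.reverse)
    fun _ _ h => Quotient.sound (Walk.Homotopic.reverse h)
  id_comp := by rintro _ _ ⟨a⟩; rfl
  comp_id := by rintro _ _ ⟨a⟩; exact congrArg (Quotient.mk _) (Walk.append_nil a)
  assoc := by
    rintro _ _ _ _ ⟨a⟩ ⟨b⟩ ⟨c⟩
    exact congrArg (Quotient.mk _) (Walk.append_assoc a b c)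
  inv_comp := by rintro _ _ ⟨a⟩; exact Quotient.sound (Walk.reverse_append_homotopic s a)
  comp_inv := by rintro _ _ ⟨a⟩; exact Quotient.sound (Walk.append_reverse_homotopic s a)

namespace Walk

variable {x y z : V}

/-- The class of a walk as a morphism of the groupoid of walks modulo `s`-homotopy. -/
def toHom (s : ℕ) (p : Walk G x y) : (⟨x⟩ : WalkGroupoid G s) ⟶ ⟨y⟩ :=
  Quotient.mk (setoid G s x y) p

theorem toHom_append (s : ℕ) (p : Walk G x y) (q : Walk G y z) :
    (p.append q).toHom s = p.toHom s ≫ q.toHom s := rfl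

theorem toHom_eq_iff {s : ℕ} {p q : Walk G x y} : p.toHom s = q.toHom s ↔ Homotopic s p q :=
  ⟨fun h => Quotient.exact h, fun h => Quotient.sound h⟩

end Walk

/-! ### Cocycles on the neighborhood complex -/

/-- A function on pairs of vertices is a cocycle on the `r`-neighborhood complex if it is
multiplicative on the triangles (written in the order of composition of functions). -/
def IsCocycle {Γ : Type*} [Group Γ] (G : SymGraph V) (r : ℕ) (E : V → V → Γ) : Prop :=
  ∀ w x y z, x ∈ G.nbhd r w → y ∈ G.nbhd r w → z ∈ G.nbhd r w → E y z * E x y = E x z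

open Classical in
/-- A neighbor of `x`, if there is one. -/
def nbr (G : SymGraph V) (x : V) : V := if h : (G.nbrs x).Nonempty then h.some else x

theorem nbr_mem {x : V} (h : (G.nbrs x).Nonempty) : G.nbr x ∈ G.nbrs x := by
  rw [nbr, dif_pos h]; exact h.some_mem

/-- The value of a cocycle on a walk. The vertices are colored alternately, the first one by `b`.
Those of color `true` are replaced by a neighbor, so that every edge of the walk becomes an edge of
the neighborhood complex. -/
def altProd {Γ : Type*} [Group Γ] (E : V → V → Γ) : Bool → ∀ {x y : V}, Walk G x y → Γ
  | _, _, _, .nil _ => 1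
  | false, x, _, .cons (y := w) _ p => altProd E true p * E x (G.nbr w)
  | true, x, _, .cons (y := w) _ p => altProd E false p * E (G.nbr x) w

section

variable {Γ : Type*} [Group Γ] {E : V → V → Γ} {r : ℕ} {x y z w : V}

@[simp] theorem altProd_nil (b : Bool) : altProd E b (Walk.nil (G := G) x) = 1 := by
  cases b <;> rfl

theorem altProd_cons_false (h : G.Adj x w) (p : Walk G w y) :
    altProd E false (.cons h p) = altProd E true p * E x (G.nbr w) := rfl

theorem altProd_cons_true (h : G.Adj x w) (p : Walk G w y) :
    altProd E true (.cons h p) = altProd E false p * E (G.nbr x) w := rfl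

theorem altProd_append (b : Bool) (p : Walk G x y) (q : Walk G y z) :
    altProd E b (p.append q) = altProd E (b ^^ p.length.bodd) q * altProd E b p := by
  induction p generalizing b with
  | nil => simp [Walk.append, Walk.length]
  | cons h p ih =>
    cases b
    · rw [Walk.append, altProd_cons_false, altProd_cons_false, ih]
      simp [Walk.length, mul_assoc]
    · rw [Walk.append, altProd_cons_true, altProd_cons_true, ih]
      simp [Walk.length, mul_assoc]

theorem IsCocycle.self (hE : IsCocycle G r E) (hx : (G.nbrs x).Nonempty) :
    E x x = 1 := by
  obtain ⟨w, hw⟩ := G.exists_mem_nbhd r x hx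
  exact mul_eq_right.1 (hE w x x x hw hw hw)

theorem IsCocycle.of_nbrs (hE : IsCocycle G r E) (hr : 1 ≤ r) (hx : G.Adj w x) (hy : G.Adj w y)
    (hz : G.Adj w z) : E y z * E x y = E x z := by
  obtain ⟨w', hw⟩ := exists_nbrs_subset_nbhd (G := G) hr ⟨x, hx⟩
  exact hE w' x y z (hw hx) (hw hy) (hw hz)

theorem IsCocycle.altProd_cons_cons (hE : IsCocycle G r E) (hr : 1 ≤ r) (h : G.Adj x w)
    (h' : G.Adj w z) (p : Walk G z y) :
    altProd E false (.cons h (.cons h' p)) = altProd E false p * E x z := by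
  rw [altProd_cons_false, altProd_cons_true, mul_assoc,
    hE.of_nbrs hr (G.symm h) (nbr_mem ⟨_, h'⟩) h']

/-- Going along an edge and back gives nothing. -/
theorem IsCocycle.altProd_backtrack (hE : IsCocycle G r E) (hr : 1 ≤ r) (b : Bool) (h : G.Adj x w)
    (h' : G.Adj w x) :
    altProd E b (.cons h (.cons h' (.nil x))) = 1 := by
  cases b
  · rw [hE.altProd_cons_cons hr, altProd_nil, one_mul, hE.self ⟨w, h⟩]
  · rw [altProd_cons_true, altProd_cons_false, altProd_nil, one_mul,
      hE.of_nbrs hr (nbr_mem ⟨w, h⟩) h (nbr_mem ⟨w, h⟩), hE.self ⟨x, G.symm (nbr_mem ⟨w, h⟩)⟩]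

theorem IsCocycle.altProd_eq_of_vert_mem (hE : IsCocycle G r E) (hr : 1 ≤ r) {c : V}
    (p : Walk G x y) (hp : Even p.length)
    (hc : ∀ i, 2 * i ≤ p.length → p.vert (2 * i) ∈ G.nbhd r c) :
    altProd E false p = E x y := by
  revert hc
  refine Walk.even_induction
    (motive := fun {x y} (p : Walk G x y) =>
      (∀ i, 2 * i ≤ p.length → p.vert (2 * i) ∈ G.nbhd r c) → altProd E false p = E x y)
    (fun x hc => ?_) (fun {x w z y} h h' p hp ih hc => ?_) p hp
  · exact (hE.self (nbrs_nonempty_of_mem_nbhd hr (hc 0 (Nat.zero_le _)))).symm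
  · have hc' : ∀ i, 2 * i ≤ p.length → p.vert (2 * i) ∈ G.nbhd r c := fun i hi => by
      have := hc (i + 1) (by simp only [Walk.length]; omega)
      exact this
    rw [hE.altProd_cons_cons hr, ih hc']
    obtain ⟨k, hk⟩ := hp
    have hx := hc 0 (Nat.zero_le _)
    have hz := hc' 0 (Nat.zero_le _)
    have hy := hc' k (by omega)
    rw [show 2 * k = p.length by omega, Walk.vert_length] at hy
    rw [mul_zero, Walk.vert_zero] at hx hz
    exact hE c x z y hx hz hy

theorem IsCocycle.altProd_false_eq (hE : IsCocycle G r E) (hr : 1 ≤ r) (p : Walk G x y)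
    (hp : p.length = 2 * r) : altProd E false p = E x y :=
  hE.altProd_eq_of_vert_mem hr p ⟨r, by omega⟩ fun i hi => p.vert_even_mem_nbhd hr hp i (by omega)

/-- A closed walk that consists of two walks of length `2 * r` has value `1` in both colorings:
rotating it by one edge exchanges the colorings, and the even case is `altProd_false_eq`. -/
theorem IsCocycle.altProd_eq_of_length_eq (hE : IsCocycle G r E) (hr : 1 ≤ r) (b : Bool)
    (p q : Walk G x y) (hp : p.length = 2 * r) (hq : q.length = 2 * r) :
    altProd E b p = altProd E b q := by
  cases b
  · rw [hE.altProd_false_eq hr p hp, hE.altProd_false_eq hr q hq]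
  obtain ⟨u, q', t, hq', rfl⟩ := q.exists_append (2 * r - 1) (by omega)
  rw [Walk.length_append] at hq
  cases t with
  | nil => simp only [Walk.length] at hq; omega
  | @cons _ y' _ k t =>
  cases t with
  | cons k' t => simp only [Walk.length] at hq; omega
  | nil =>
  cases p with
  | nil => simp only [Walk.length] at hp; omega
  | @cons _ x₁ _ h p =>
  have hpl : p.length = 2 * r - 1 := by simp only [Walk.length] at hp; omega
  have hodd : (2 * r - 1).bodd = true := by
    obtain ⟨r, rfl⟩ := Nat.exists_eq_add_of_le' hr
    rw [show 2 * (r + 1) - 1 = 2 * r + 1 by omega]; simp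
  have h1 := hE.altProd_false_eq hr (p.append (.cons (G.symm k) (.nil u)))
    (by simp only [Walk.length_append, Walk.length]; omega)
  have h2 := hE.altProd_false_eq hr (Walk.cons (G.symm h) q')
    (by simp only [Walk.length]; omega)
  rw [altProd_append, hpl, hodd] at h1
  rw [altProd_cons_false] at h2
  have h3 := hE.altProd_backtrack hr false k (G.symm k)
  have h4 := hE.altProd_backtrack hr false (G.symm h) h
  rw [altProd_cons_false] at h3 h4
  rw [altProd_append, hq', hodd, altProd_cons_true]
  simp only [Bool.false_xor, Bool.xor_self, altProd_cons_true, altProd_cons_false,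
    altProd_nil, one_mul] at h1 h2 h3 h4 ⊢
  rw [← h2] at h1
  rw [eq_inv_of_mul_eq_one_right h3, eq_inv_of_mul_eq_one_left h4, mul_inv_eq_iff_eq_mul,
    mul_assoc, ← h1, inv_mul_cancel_left]

/-- The value of a cocycle on short walks depends only on their ends and their length: prolong them
by the same walk to length `2 * r`. -/
theorem IsCocycle.altProd_eq_of_length_le (hE : IsCocycle G r E) (hr : 1 ≤ r) (b : Bool)
    (p q : Walk G x y) (hl : q.length = p.length) (hp : p.length ≤ 2 * r) :
    altProd E b p = altProd E b q := by
  by_cases hx : (G.nbrs x).Nonempty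
  · obtain ⟨u, t, ht⟩ := Walk.exists_length_eq (p.nbrs_end_nonempty hx) (2 * r - p.length)
    have h := hE.altProd_eq_of_length_eq hr b (p.append t) (q.append t)
      (by simp; omega) (by simp; omega)
    rw [altProd_append, altProd_append, hl] at h
    exact mul_left_cancel h
  · cases p with
    | cons h p => exact absurd ⟨_, h⟩ hx
    | nil => cases q with
      | cons h q => exact absurd ⟨_, h⟩ hx
      | nil => rfl

theorem IsCocycle.altProd_eq_of_backtrack (hE : IsCocycle G r E) (hr : 1 ≤ r) (k : ℕ) (b : Bool)
    (p q : Walk G x y) (hk : k ≤ p.length) (hl : q.length = p.length + 2)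
    (hle : ∀ i ≤ k, p.vert i = q.vert i)
    (hge : ∀ i, k ≤ i → i ≤ p.length → p.vert i = q.vert (i + 2)) :
    altProd E b p = altProd E b q := by
  induction k generalizing b x with
  | zero =>
    cases q with
    | nil => simp [Walk.length] at hl
    | cons h q =>
    cases q with
    | nil => simp [Walk.length] at hl
    | cons h' q =>
      have h0 := hge 0 le_rfl (Nat.zero_le _)
      simp only [Walk.vert, Walk.vert_zero] at h0
      subst h0
      obtain rfl : p = q := Walk.ext_vert p q (by simp only [Walk.length] at hl; omega)
        fun i hi => hge i (Nat.zero_le _) hi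
      have := altProd_append (E := E) b (.cons h (.cons h' (.nil x))) p
      rw [hE.altProd_backtrack hr] at this
      simpa [Walk.append, Walk.length] using this.symm
  | succ k ih =>
    cases p with
    | nil => simp [Walk.length] at hk
    | cons h p =>
    cases q with
    | nil => simp [Walk.length] at hl
    | cons h' q =>
      have h0 := hle 1 (by omega)
      simp only [Walk.vert, Walk.vert_zero] at h0
      subst h0
      have := fun b => ih b p q (by simp only [Walk.length] at hk; omega)
        (by simp only [Walk.length] at hl; omega) (fun i hi => hle (i + 1) (by omega))
        (fun i hi hi' => hge (i + 1) (by omega) (by simp only [Walk.length]; omega))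
      cases b
      · rw [altProd_cons_false, altProd_cons_false, this]
      · rw [altProd_cons_true, altProd_cons_true, this]

theorem IsCocycle.altProd_eq_of_replace (hE : IsCocycle G r E) (hr : 1 ≤ r) (k : ℕ) (b : Bool)
    (p q : Walk G x y) (hl : q.length = p.length)
    (heq : ∀ i ≤ p.length, (i ≤ k ∨ k + 2 * r ≤ i) → p.vert i = q.vert i) :
    altProd E b p = altProd E b q := by
  induction k generalizing b x with
  | zero =>
    rcases Nat.le_total p.length (2 * r) with h | h
    · exact hE.altProd_eq_of_length_le hr b p q hl h
    · obtain ⟨z, a, c, ha, rfl⟩ := p.exists_append (2 * r) h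
      obtain ⟨z', a', c', ha', rfl⟩ := q.exists_append (2 * r) (by omega)
      have hz := heq (2 * r) h (by omega)
      rw [Walk.vert_append_left _ _ _ ha.ge, Walk.vert_append_left _ _ _ ha'.ge, ← ha,
        Walk.vert_length, ha, ← ha', Walk.vert_length] at hz
      subst hz
      simp only [Walk.length_append] at hl
      obtain rfl : c = c' := Walk.ext_vert c c' (by omega) fun i hi => by
        have := heq (a.length + i) (by simp; omega) (by omega)
        rwa [Walk.vert_append_right, ha, ← ha', Walk.vert_append_right] at this
      rw [altProd_append, altProd_append,
        hE.altProd_eq_of_length_le hr b a a' (by omega) (by omega), ha, ha']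
  | succ k ih =>
    cases p with
    | nil => cases q with
      | nil => rfl
      | cons h q => simp [Walk.length] at hl
    | cons h p =>
    cases q with
    | nil => simp [Walk.length] at hl
    | cons h' q =>
      have h0 := heq 1 (by simp [Walk.length]) (by omega)
      simp only [Walk.vert, Walk.vert_zero] at h0
      subst h0
      have := fun b => ih b p q (by simp only [Walk.length] at hl; omega)
        (fun i hi hi' => heq (i + 1) (by simp only [Walk.length]; omega) (by omega))
      cases b
      · rw [altProd_cons_false, altProd_cons_false, this]
      · rw [altProd_cons_true, altProd_cons_true, this]

/-- The value of a cocycle on a walk is invariant under `2 * r`-homotopy. -/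
theorem IsCocycle.altProd_eq_of_homotopic (hE : IsCocycle G r E) (hr : 1 ≤ r) (b : Bool)
    {p q : Walk G x y} (h : Walk.Homotopic (2 * r) p q) : altProd E b p = altProd E b q := by
  induction h with
  | refl _ => rfl
  | symm _ _ _ ih => exact ih.symm
  | trans _ _ _ _ _ ih ih' => exact ih.trans ih'
  | rel p q h =>
    cases h with
    | backtrack k hk hl hle hge => exact hE.altProd_eq_of_backtrack hr k b p q hk hl hle hge
    | replace k hl heq =>
      -- position `0` is fixed by the type, also when the replaced positions begin at `0`
      refine hE.altProd_eq_of_replace hr (k - 1) b p q hl fun i hi h => ?_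
      rcases Nat.eq_zero_or_pos i with rfl | hi0
      · rw [Walk.vert_zero, Walk.vert_zero]
      · exact heq i hi (by omega)

/-- The homomorphism on the even part of `π₁^{2r}(G, x)` given by a cocycle. -/
def IsCocycle.evenHom (hE : IsCocycle G r E) (hr : 1 ≤ r) (x : V) : G.evenPart (2 * r) x →* Γ where
  toFun a := Quotient.liftOn a.1 (fun p => altProd E false p)
    fun _ _ h => hE.altProd_eq_of_homotopic hr false h
  map_one' := rfl
  map_mul' := by
    rintro ⟨_, q, hq, rfl⟩ ⟨_, p, hp, rfl⟩
    have h : p.length.bodd = false := by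
      obtain ⟨k, hk⟩ := hp
      rw [hk, Nat.bodd_add, Bool.xor_self]
    have := altProd_append (E := E) false p q
    rwa [h] at this

end

/-! ### The tautological cocycle -/

section

variable (G) (r : ℕ) (v : V)

open Classical in
/-- The cocycle with values in the group of walk classes at `v` that sends an edge of the
`r`-neighborhood complex to the class of the walks of length `2 * r` between its ends, made a loop
at `v`. -/
def walkCocycle (x y : V) : End (⟨v⟩ : WalkGroupoid G (2 * r)) :=
  if h : ∃ p : Walk G x y, p.length = 2 * r then
    Groupoid.retract ⟨v⟩ (h.choose.toHom (2 * r)) else 1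

variable {G r}

theorem walkCocycle_eq {x y : V} (p q : Walk G x y) (hp : p.length = 2 * r)
    (hq : Walk.Homotopic (2 * r) p q) :
    walkCocycle G r v x y = Groupoid.retract ⟨v⟩ (q.toHom (2 * r)) := by
  have h : ∃ p : Walk G x y, p.length = 2 * r := ⟨p, hp⟩
  rw [walkCocycle, dif_pos h, Walk.toHom_eq_iff.2]
  exact (Walk.homotopic_of_length_le _ _ (by rw [hp, h.choose_spec]) h.choose_spec.le).trans hq

theorem isCocycle_walkCocycle : IsCocycle G r (walkCocycle G r v) := by
  intro w x y z hx hy hz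
  obtain ⟨a, ha⟩ := Walk.exists_of_mem_nbhd hx
  obtain ⟨b, hb⟩ := Walk.exists_of_mem_nbhd hy
  obtain ⟨c, hc⟩ := Walk.exists_of_mem_nbhd hz
  rw [walkCocycle_eq v (a.reverse.append b) _ (by simp; omega) (.refl _),
    walkCocycle_eq v (b.reverse.append c) _ (by simp; omega) (.refl _),
    walkCocycle_eq v (a.reverse.append c) _ (by simp; omega) (.refl _),
    ← Groupoid.retract_comp, ← Walk.toHom_append, Walk.toHom_eq_iff.2]
  rw [Walk.append_assoc, ← Walk.append_assoc b]
  exact (Walk.Homotopic.refl _).append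
    ((Walk.append_reverse_homotopic _ b).append (Walk.Homotopic.refl c))

theorem altProd_walkCocycle (hr : 1 ≤ r) {x y : V} (p : Walk G x y) (hp : Even p.length) :
    altProd (walkCocycle G r v) false p = Groupoid.retract ⟨v⟩ (p.toHom (2 * r)) := by
  refine Walk.even_induction
    (motive := fun {x y} (p : Walk G x y) =>
      altProd (walkCocycle G r v) false p = Groupoid.retract ⟨v⟩ (p.toHom (2 * r)))
    (fun x => ?_) (fun {x w z y} h h' p hp ih => ?_) p hp
  · rw [altProd_nil]
    exact (Groupoid.retract_id _ _).symm
  · obtain ⟨q, hq, hq'⟩ := Walk.exists_homotopic_length_add (s := 2 * r)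
      (Walk.cons h (.cons h' (.nil z))) ⟨w, G.symm h'⟩ (r - 1)
    simp only [Walk.length] at hq
    rw [(isCocycle_walkCocycle v).altProd_cons_cons hr, ih,
      walkCocycle_eq v q _ (by omega) hq', ← Groupoid.retract_comp, ← Walk.toHom_append]
    rfl

end

end SymGraph

/-! ### The cover of a simplicial complex by the open stars of its vertices -/

namespace Convexity.StdSimplex

variable {V : Type u}

/-- The point `(1 - t) a + t b`. -/
def mix (t : unitInterval) (a b : StdSimplex ℝ V) : StdSimplex ℝ V where
  weights := (1 - t : ℝ) • a.weights + (t : ℝ) • b.weights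
  nonneg := add_nonneg (smul_nonneg (sub_nonneg.2 t.2.2) a.nonneg) (smul_nonneg t.2.1 b.nonneg)
  total := by
    rw [Finsupp.sum_add_index' (by simp) (by simp), Finsupp.sum_smul_index' (by simp),
      Finsupp.sum_smul_index' (by simp)]
    simp only [smul_eq_mul, ← Finsupp.mul_sum, a.total, b.total]
    ring

theorem weights_mix (t : unitInterval) (a b : StdSimplex ℝ V) (x : V) :
    (mix t a b).weights x = (1 - t) * a.weights x + t * b.weights x := rfl

theorem mix_zero (a b : StdSimplex ℝ V) : mix 0 a b = a := by
  ext x; simp [weights_mix]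

theorem mix_one (a b : StdSimplex ℝ V) : mix 1 a b = b := by
  ext x; simp [weights_mix]

theorem support_mix_subset (t : unitInterval) {a b : StdSimplex ℝ V} {σ : Finset V}
    (ha : a.weights.support ⊆ σ) (hb : b.weights.support ⊆ σ) :
    (mix t a b).weights.support ⊆ σ := by
  intro x hx
  by_contra h
  have h1 : a.weights x = 0 := Finsupp.notMem_support_iff.1 fun k => h (ha k)
  have h2 : b.weights x = 0 := Finsupp.notMem_support_iff.1 fun k => h (hb k)
  rw [Finsupp.mem_support_iff, weights_mix, h1, h2] at hx
  simp at hx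

theorem mix_pos (t : unitInterval) {a b : StdSimplex ℝ V} {x : V} (ha : 0 < a.weights x)
    (hb : 0 < b.weights x) : 0 < (mix t a b).weights x := by
  rw [weights_mix]
  rcases t.2.1.eq_or_lt with h | h
  · rw [← h]; simpa using ha
  · exact add_pos_of_nonneg_of_pos (mul_nonneg (sub_nonneg.2 t.2.2) ha.le) (mul_pos h hb)

/-- The barycenter of a finite set of vertices. -/
def barycenter (σ : Finset V) (hσ : σ.Nonempty) : StdSimplex ℝ V where
  weights := Finsupp.indicator σ fun _ _ => (σ.card : ℝ)⁻¹
  nonneg := fun x => by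
    classical
    rw [Finsupp.indicator_apply]
    split_ifs <;> simp
  total := by
    classical
    rw [Finsupp.sum_of_support_subset _ (Finsupp.support_indicator_subset _ _) _ (by simp),
      Finset.sum_congr rfl fun x hx => Finsupp.indicator_of_mem hx _]
    simp [hσ.card_ne_zero]

theorem barycenter_pos {σ : Finset V} (hσ : σ.Nonempty) {x : V} (hx : x ∈ σ) :
    0 < (barycenter σ hσ).weights x := by
  have : (barycenter σ hσ).weights x = (σ.card : ℝ)⁻¹ :=
    Finsupp.indicator_of_mem hx fun _ _ => (σ.card : ℝ)⁻¹
  rw [this]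
  exact inv_pos.2 (Nat.cast_pos.2 hσ.card_pos)

theorem support_barycenter_subset {σ : Finset V} (hσ : σ.Nonempty) :
    (barycenter σ hσ).weights.support ⊆ σ := Finsupp.support_indicator_subset _ _

end Convexity.StdSimplex

namespace PreAbstractSimplicialComplex

open Convexity.StdSimplex

variable {V : Type u} (K : PreAbstractSimplicialComplex V)

theorem mem_faces_of_support_subset {a : Convexity.StdSimplex ℝ V} {σ : Finset V}
    (hσ : σ ∈ K.faces) (h : a.weights.support ⊆ σ) : a.weights.support ∈ K.faces :=
  (K.isRelLowerSet_faces hσ).2 h (Convexity.StdSimplex.support_weights_nonempty _)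

theorem continuous_incl {σ : Finset V} (hσ : σ ∈ K.faces) :
    Continuous (ClosedSimplex.incl : K.ClosedSimplex σ → K.Realization) := by
  rw [continuous_iff_coinduced_le]
  exact le_iSup (fun τ : K.faces => TopologicalSpace.coinduced
    (ClosedSimplex.incl : K.ClosedSimplex τ.1 → K.Realization) inferInstance) ⟨_, hσ⟩

variable {K} in
theorem continuous_closedSimplex_weights {σ : Finset V} (x : V) :
    Continuous fun p : K.ClosedSimplex σ => p.incl.pt.weights x :=
  (continuous_apply x).comp continuous_induced_dom

variable {K} in
theorem continuous_weights (x : V) : Continuous fun p : K.Realization => p.pt.weights x := by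
  rw [continuous_iSup_dom]
  intro σ
  rw [continuous_coinduced_dom]
  exact continuous_closedSimplex_weights x

/-- The realization is the quotient of the disjoint union of its closed simplices. -/
theorem isQuotientMap_incl :
    IsQuotientMap fun p : Σ σ : K.faces, K.ClosedSimplex σ.1 => p.2.incl := by
  refine ⟨⟨?_⟩, fun a => ⟨⟨⟨_, a.support_mem⟩, ⟨a, subset_rfl⟩⟩, rfl⟩⟩
  rw [instTopologicalSpaceSigma, coinduced_iSup]
  rfl

/-- The open star of a vertex. -/
def star (x : V) : Set K.Realization := {p | 0 < p.pt.weights x}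

variable {K}

theorem isOpen_star (x : V) : IsOpen (K.star x) :=
  isOpen_lt continuous_const (continuous_weights x)

theorem mem_support_of_mem_star {x : V} {a : K.Realization} (h : a ∈ K.star x) :
    x ∈ a.pt.weights.support :=
  Finsupp.mem_support_iff.2 (ne_of_gt h)

theorem exists_mem_star (a : K.Realization) : ∃ x, a ∈ K.star x := by
  obtain ⟨x, hx⟩ := a.pt.support_weights_nonempty
  exact ⟨x, lt_of_le_of_ne (weights_nonneg x) (Ne.symm (Finsupp.mem_support_iff.1 hx))⟩

theorem singleton_mem_faces_of_mem_star {x : V} {a : K.Realization} (h : a ∈ K.star x) :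
    {x} ∈ K.faces :=
  (K.isRelLowerSet_faces a.support_mem).2
    (Finset.singleton_subset_iff.2 (mem_support_of_mem_star h)) (Finset.singleton_nonempty x)

theorem vertexPt_mem_star (x : V) (hx : {x} ∈ K.faces) : K.vertexPt x hx ∈ K.star x := by
  simp [star, vertexPt]

/-- The straight path between two points of a closed simplex. -/
def segmentPath (a b : K.Realization) (σ : Finset V) (hσ : σ ∈ K.faces)
    (ha : a.pt.weights.support ⊆ σ) (hb : b.pt.weights.support ⊆ σ) : Path a b where
  toFun t := ⟨mix t a.pt b.pt, K.mem_faces_of_support_subset hσ (support_mix_subset t ha hb)⟩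
  continuous_toFun := by
    let g : unitInterval → K.ClosedSimplex σ := fun t =>
      ⟨⟨mix t a.pt b.pt, K.mem_faces_of_support_subset hσ (support_mix_subset t ha hb)⟩,
        support_mix_subset t ha hb⟩
    have hg : Continuous g := by
      rw [continuous_induced_rng, continuous_pi_iff]
      intro x
      have : Continuous fun t : unitInterval =>
          (1 - (t : ℝ)) * a.pt.weights x + t * b.pt.weights x := by fun_prop
      exact this
    exact (K.continuous_incl hσ).comp hg
  source' := Realization.ext (mix_zero _ _)
  target' := Realization.ext (mix_one _ _)

theorem segmentPath_mem_star {a b : K.Realization} {σ : Finset V} (hσ : σ ∈ K.faces)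
    (ha : a.pt.weights.support ⊆ σ) (hb : b.pt.weights.support ⊆ σ) {x : V} (hxa : a ∈ K.star x)
    (hxb : b ∈ K.star x) (t : unitInterval) : segmentPath a b σ hσ ha hb t ∈ K.star x :=
  mix_pos t hxa hxb

theorem support_vertexPt_subset {x : V} (hx : {x} ∈ K.faces) {σ : Finset V} (h : x ∈ σ) :
    (K.vertexPt x hx).pt.weights.support ⊆ σ := by
  change (single (R := ℝ) x).weights.support ⊆ σ
  rw [support_weights_eq_singleton.2 rfl]
  exact Finset.singleton_subset_iff.2 h

theorem joinedIn_star {x : V} (hx : {x} ∈ K.faces) {a : K.Realization} (ha : a ∈ K.star x) :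
    JoinedIn (K.star x) (K.vertexPt x hx) a :=
  ⟨segmentPath _ _ _ a.support_mem (support_vertexPt_subset hx (mem_support_of_mem_star ha))
    subset_rfl, segmentPath_mem_star _ _ _ (vertexPt_mem_star x hx) ha⟩

/-- The barycenter of a simplex as a point of the realization. -/
def barycenterPt {σ : Finset V} (hσ : σ ∈ K.faces) : K.Realization :=
  ⟨barycenter σ (K.isRelLowerSet_faces hσ).1,
    K.mem_faces_of_support_subset hσ (support_barycenter_subset _)⟩

theorem barycenterPt_mem_star {σ : Finset V} (hσ : σ ∈ K.faces) {x : V} (hx : x ∈ σ) :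
    barycenterPt hσ ∈ K.star x :=
  barycenter_pos (K.isRelLowerSet_faces hσ).1 hx

theorem joinedIn_star_inter {x y : V} {a b : K.Realization} (hax : a ∈ K.star x)
    (hay : a ∈ K.star y) (hbx : b ∈ K.star x) (hby : b ∈ K.star y) :
    JoinedIn (K.star x ∩ K.star y) a b := by
  classical
  -- both points are joined to the midpoint of the edge from `x` to `y`
  have hsub : ∀ d : K.Realization, d ∈ K.star x → d ∈ K.star y →
      ({x, y} : Finset V) ⊆ d.pt.weights.support := fun d hx hy => by
    intro z hz
    rcases Finset.mem_insert.1 hz with rfl | hz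
    · exact mem_support_of_mem_star hx
    · rw [Finset.mem_singleton.1 hz]
      exact mem_support_of_mem_star hy
  have hf : ({x, y} : Finset V) ∈ K.faces :=
    (K.isRelLowerSet_faces a.support_mem).2 (hsub a hax hay) (Finset.insert_nonempty _ _)
  have hmx : barycenterPt hf ∈ K.star x := barycenterPt_mem_star hf (by simp)
  have hmy : barycenterPt hf ∈ K.star y := barycenterPt_mem_star hf (by simp)
  have key : ∀ d : K.Realization, d ∈ K.star x → d ∈ K.star y →
      JoinedIn (K.star x ∩ K.star y) d (barycenterPt hf) := fun d hx hy =>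
    ⟨segmentPath d _ _ d.support_mem subset_rfl
      ((support_barycenter_subset (K.isRelLowerSet_faces hf).1).trans (hsub d hx hy)),
      fun t => ⟨segmentPath_mem_star _ _ _ hx hmx t, segmentPath_mem_star _ _ _ hy hmy t⟩⟩
  exact (key a hax hay).trans (key b hbx hby).symm

/-- The straight contraction of an open star onto its vertex. -/
def starContraction {x : V} (p : K.star x × unitInterval) : K.star x :=
  ⟨⟨mix p.2 p.1.1.pt (single x), K.mem_faces_of_support_subset p.1.1.support_mem
    (support_mix_subset _ subset_rfl (support_vertexPt_subset
      (singleton_mem_faces_of_mem_star p.1.2) (mem_support_of_mem_star p.1.2)))⟩,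
    mix_pos _ p.1.2 (by simp)⟩

theorem continuous_starContraction (x : V) : Continuous (starContraction (K := K) (x := x)) := by
  have hq := K.isQuotientMap_incl.restrictPreimage_isOpen (isOpen_star x)
  refine hq.continuous_lift_prod_left ?_
  rw [continuous_iff_continuousAt]
  rintro ⟨⟨⟨σ, p⟩, hp⟩, t⟩
  -- it suffices to look at one closed simplex
  let D := (fun p : Σ σ : K.faces, K.ClosedSimplex σ.1 => p.2.incl) ⁻¹' K.star x
  have he : IsOpenEmbedding (Prod.map (D.restrictPreimage (Sigma.mk σ)) (id : unitInterval → _)) :=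
    (IsOpenEmbedding.restrictPreimage D IsOpenEmbedding.sigmaMk).prodMap .id
  refine (he.continuousAt_iff (x := (⟨p, hp⟩, t))).1 (Continuous.continuousAt ?_)
  refine Continuous.subtype_mk ?_ _
  let g : (Sigma.mk σ ⁻¹' D) × unitInterval → K.ClosedSimplex σ.1 := fun d =>
    ⟨(starContraction (⟨d.1.1.incl, d.1.2⟩, d.2)).1, support_mix_subset _ d.1.1.2
      (support_vertexPt_subset (singleton_mem_faces_of_mem_star d.1.2)
        (d.1.1.2 (mem_support_of_mem_star d.1.2)))⟩
  have hg : Continuous g := by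
    rw [continuous_induced_rng, continuous_pi_iff]
    intro y
    have h1 : Continuous fun d : (Sigma.mk σ ⁻¹' D) × unitInterval =>
        d.1.1.incl.pt.weights y :=
      (continuous_closedSimplex_weights y).comp (continuous_subtype_val.comp continuous_fst)
    have : Continuous fun d : (Sigma.mk σ ⁻¹' D) × unitInterval =>
        (1 - (d.2 : ℝ)) * d.1.1.incl.pt.weights y + d.2 * (single (R := ℝ) x).weights y := by
      fun_prop
    exact this
  exact (K.continuous_incl σ.2).comp hg

theorem contractibleSpace_star {x : V} (hx : {x} ∈ K.faces) : ContractibleSpace (K.star x) := by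
  rw [contractible_iff_id_nullhomotopic]
  refine ⟨⟨K.vertexPt x hx, vertexPt_mem_star x hx⟩, ⟨⟨⟨fun p => starContraction (p.2, p.1),
    (continuous_starContraction x).comp continuous_swap⟩, fun a => ?_, fun a => ?_⟩⟩⟩
  · exact Subtype.ext (Realization.ext (mix_zero _ _))
  · exact Subtype.ext (Realization.ext (mix_one _ _))

theorem homotopic_of_mem_star {x : V} (hx : {x} ∈ K.faces) {a b : K.Realization} (γ γ' : Path a b)
    (hγ : ∀ t, γ t ∈ K.star x) (hγ' : ∀ t, γ' t ∈ K.star x) : γ.Homotopic γ' := by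
  have := contractibleSpace_star hx
  have ha : a ∈ K.star x := by rw [← γ.source]; exact hγ 0
  have hb : b ∈ K.star x := by rw [← γ.target]; exact hγ 1
  let lift : ∀ δ : Path a b, (∀ t, δ t ∈ K.star x) → Path (⟨a, ha⟩ : K.star x) ⟨b, hb⟩ :=
    fun δ hδ => ⟨⟨fun t => ⟨δ t, hδ t⟩, δ.continuous.subtype_mk _⟩, Subtype.ext δ.source,
      Subtype.ext δ.target⟩
  exact (SimplyConnectedSpace.paths_homotopic (lift γ hγ) (lift γ' hγ')).map
    ⟨Subtype.val, continuous_subtype_val⟩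

variable (K) in
/-- The cover of a realization by the open stars of the vertices of the complex. -/
def starCover : GoodCover K.Realization {x : V // {x} ∈ K.faces} where
  U i := K.star i.1
  pt i := K.vertexPt i.1 i.2
  isOpen i := isOpen_star i.1
  exists_mem a := by
    obtain ⟨x, hx⟩ := exists_mem_star a
    exact ⟨⟨x, singleton_mem_faces_of_mem_star hx⟩, hx⟩
  pt_mem i := vertexPt_mem_star i.1 i.2
  joined i _ ha := joinedIn_star i.2 ha
  homotopic i _ _ γ γ' hγ hγ' := homotopic_of_mem_star i.2 γ γ' hγ hγ'
  joined_inter _ _ _ _ := joinedIn_star_inter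

theorem realizationMap_mem_star {W : Type v} {L : PreAbstractSimplicialComplex W} {f : V → W}
    (hf : IsSimplicialMap K L f) {x : V} {a : K.Realization} (ha : a ∈ K.star x) :
    realizationMap hf a ∈ L.star (f x) := by
  classical
  change 0 < (a.pt.map f).weights (f x)
  rw [weights_map, Finsupp.mapDomain, Finsupp.sum_apply]
  refine Finset.sum_pos' (fun y _ => ?_) ⟨x, mem_support_of_mem_star ha, ?_⟩
  · dsimp only
    rw [Finsupp.single_apply]
    split_ifs
    · exact weights_nonneg y
    · exact le_rfl
  · dsimp only
    rw [Finsupp.single_eq_same]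
    exact ha

end PreAbstractSimplicialComplex

/-! ### Maps between covered spaces -/

namespace GoodCover

variable {X Y ι κ : Type*} [TopologicalSpace X] [TopologicalSpace Y]

/-- The map of classes of paths induced by a continuous map whose values at the ends are known up
to a propositional equality. -/
def mapHom (F : C(X, Y)) {a b : X} {a' b' : Y} (ha : F a = a') (hb : F b = b')
    (q : FundamentalGroupoid.mk a ⟶ FundamentalGroupoid.mk b) :
    FundamentalGroupoid.mk a' ⟶ FundamentalGroupoid.mk b' :=
  (Path.Homotopic.Quotient.map q F).cast ha.symm hb.symm

theorem mapHom_id (F : C(X, Y)) {a : X} {a' : Y} (ha : F a = a') :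
    mapHom F ha ha (𝟙 _) = 𝟙 _ := by
  subst ha
  exact (FundamentalGroupoid.map F).map_id (FundamentalGroupoid.mk a)

theorem mapHom_comp (F : C(X, Y)) {a b d : X} {a' b' d' : Y} (ha : F a = a') (hb : F b = b')
    (hd : F d = d') (q : FundamentalGroupoid.mk a ⟶ FundamentalGroupoid.mk b)
    (q' : FundamentalGroupoid.mk b ⟶ FundamentalGroupoid.mk d) :
    mapHom F ha hd (q ≫ q') = mapHom F ha hb q ≫ mapHom F hb hd q' := by
  subst ha hb hd
  obtain ⟨γ, rfl⟩ := homMk_surjective q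
  obtain ⟨δ, rfl⟩ := homMk_surjective q'
  exact congrArg homMk (Path.map_trans γ δ F.continuous)

variable (c : GoodCover X ι) (d : GoodCover Y κ)

theorem mapHom_edge (F : C(X, Y)) (φ : ι → κ) (hpt : ∀ i, F (c.pt i) = d.pt (φ i))
    (hU : ∀ i, ∀ a ∈ c.U i, F a ∈ d.U (φ i)) (i j : ι) (h : ∃ a, a ∈ c.U i ∧ a ∈ c.U j)
    (h' : ∃ a, a ∈ d.U (φ i) ∧ a ∈ d.U (φ j)) :
    mapHom F (hpt i) (hpt j) (c.edge i j h) = d.edge (φ i) (φ j) h' := by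
  obtain ⟨a, hi, hj⟩ := id h
  have hray : ∀ (k : ι) (hk : a ∈ c.U k),
      mapHom F (hpt k) rfl (c.ray k a hk) = d.ray (φ k) (F a) (hU k a hk) := fun k hk =>
    (d.ray_eq (φ k) (((c.joined k a hk).somePath.map F.continuous).cast (hpt k).symm rfl)
      (fun t => hU k _ ((c.joined k a hk).somePath_mem t)) (hU k a hk)).symm
  have hinv : ∀ (k : ι) (hk : a ∈ c.U k), mapHom F rfl (hpt k) (Groupoid.inv (c.ray k a hk)) =
      Groupoid.inv (mapHom F (hpt k) rfl (c.ray k a hk)) := fun k hk => by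
    have h1 : mapHom F (hpt k) rfl (c.ray k a hk) ≫
        mapHom F rfl (hpt k) (Groupoid.inv (c.ray k a hk)) = 𝟙 _ := by
      rw [← mapHom_comp, Groupoid.comp_inv, mapHom_id]
    rw [← Category.id_comp (mapHom F rfl (hpt k) _), ← Groupoid.inv_comp, Category.assoc, h1,
      Category.comp_id]
  rw [c.edge_eq i j h a hi hj, d.edge_eq _ _ h' (F a) (hU i a hi) (hU j a hj),
    mapHom_comp F (hpt i) rfl (hpt j), hinv, hray, hray]

end GoodCover

/-! ### The fundamental group of the neighborhood complex -/

namespace SymGraph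

open PreAbstractSimplicialComplex Walk

variable {V : Type u} {W : Type v} (G : SymGraph V) (r : ℕ)

/-- The cover of the neighborhood complex by the open stars. -/
abbrev nbhdCover :
    GoodCover (G.nbhdComplex r).Realization {x : V // {x} ∈ (G.nbhdComplex r).faces} :=
  (G.nbhdComplex r).starCover

variable {G r}

theorem exists_mem_stars {w x y z : V} (hx : x ∈ G.nbhd r w) (hy : y ∈ G.nbhd r w)
    (hz : z ∈ G.nbhd r w) : ∃ a, a ∈ (G.nbhdComplex r).star x ∧ a ∈ (G.nbhdComplex r).star y ∧
      a ∈ (G.nbhdComplex r).star z := by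
  classical
  have hf : ({x, y, z} : Finset V) ∈ (G.nbhdComplex r).faces := by
    refine ⟨Finset.insert_nonempty _ _, w, ?_⟩
    simp [Set.insert_subset_iff, hx, hy, hz]
  exact ⟨barycenterPt hf, barycenterPt_mem_star hf (by simp), barycenterPt_mem_star hf (by simp),
    barycenterPt_mem_star hf (by simp)⟩

theorem exists_mem_nbhd_of_mem_star (a : (G.nbhdComplex r).Realization) :
    ∃ w, ∀ x, a ∈ (G.nbhdComplex r).star x → x ∈ G.nbhd r w := by
  obtain ⟨-, w, hw⟩ := a.support_mem
  exact ⟨w, fun x hx => hw (mem_support_of_mem_star hx)⟩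

variable (i₀ : {x : V // {x} ∈ (G.nbhdComplex r).faces})

open Classical in
/-- The cocycle with values in the fundamental group of the neighborhood complex that sends an edge
to its class, made a loop at the base point. -/
def edgeCocycle (x y : V) : End (FundamentalGroupoid.mk ((G.nbhdCover r).pt i₀)) :=
  if h : ∃ a, a ∈ (G.nbhdComplex r).star x ∧ a ∈ (G.nbhdComplex r).star y then
    Groupoid.retract _ ((G.nbhdCover r).edge
      ⟨x, singleton_mem_faces_of_mem_star h.choose_spec.1⟩
      ⟨y, singleton_mem_faces_of_mem_star h.choose_spec.2⟩ h)
  else 1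

theorem edgeCocycle_eq (i j : {x : V // {x} ∈ (G.nbhdComplex r).faces})
    (h : ∃ a, a ∈ (G.nbhdCover r).U i ∧ a ∈ (G.nbhdCover r).U j) :
    edgeCocycle i₀ i.1 j.1 = Groupoid.retract _ ((G.nbhdCover r).edge i j h) :=
  dif_pos h

theorem isCocycle_edgeCocycle : IsCocycle G r (edgeCocycle i₀) := by
  intro w x y z hx hy hz
  obtain ⟨a, hax, hay, haz⟩ := exists_mem_stars hx hy hz
  let i : {x : V // {x} ∈ (G.nbhdComplex r).faces} := ⟨x, singleton_mem_faces_of_mem_star hax⟩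
  let j : {x : V // {x} ∈ (G.nbhdComplex r).faces} := ⟨y, singleton_mem_faces_of_mem_star hay⟩
  let k : {x : V // {x} ∈ (G.nbhdComplex r).faces} := ⟨z, singleton_mem_faces_of_mem_star haz⟩
  rw [edgeCocycle_eq i₀ j k ⟨a, hay, haz⟩, edgeCocycle_eq i₀ i j ⟨a, hax, hay⟩,
    edgeCocycle_eq i₀ i k ⟨a, hax, haz⟩, ← Groupoid.retract_comp,
    (G.nbhdCover r).edge_comp i j k _ _ _ ⟨a, hax, hay, haz⟩]

theorem exists_mem_star_inter_of_adj (hr : 1 ≤ r) {x w z : V} (h : G.Adj x w) (h' : G.Adj w z) :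
    ∃ a, a ∈ (G.nbhdComplex r).star x ∧ a ∈ (G.nbhdComplex r).star z := by
  obtain ⟨w', hw⟩ := exists_nbrs_subset_nbhd (G := G) (x := w) hr ⟨z, h'⟩
  obtain ⟨a, hx, hz, -⟩ := exists_mem_stars (hw (G.symm h)) (hw h') (hw h')
  exact ⟨a, hx, hz⟩

/-- Induction along the edge path through the vertices of even index of a walk: `q` is the class of
that path. -/
theorem exists_hom_of_even (hr : 1 ≤ r)
    (P : ∀ i j : {x : V // {x} ∈ (G.nbhdComplex r).faces}, Walk G i.1 j.1 →
      (FundamentalGroupoid.mk ((G.nbhdCover r).pt i) ⟶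
        FundamentalGroupoid.mk ((G.nbhdCover r).pt j)) → Prop)
    (h_nil : ∀ i, P i i (.nil i.1) (𝟙 _))
    (h_cons : ∀ i k j (w : V) (h : G.Adj i.1 w) (h' : G.Adj w k.1) (p : Walk G k.1 j.1) q hik,
      P k j p q → P i j (.cons h (.cons h' p)) ((G.nbhdCover r).edge i k hik ≫ q))
    {x y : V} (p : Walk G x y) (hp : Even p.length) (hx : {x} ∈ (G.nbhdComplex r).faces)
    (hy : {y} ∈ (G.nbhdComplex r).faces) :
    ∃ q, P ⟨x, hx⟩ ⟨y, hy⟩ p q ∧ Groupoid.retract _ q = altProd (edgeCocycle i₀) false p := by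
  revert hx hy
  refine Walk.even_induction
    (motive := fun {x y} (p : Walk G x y) => ∀ (hx : {x} ∈ (G.nbhdComplex r).faces)
      (hy : {y} ∈ (G.nbhdComplex r).faces), ∃ q, P ⟨x, hx⟩ ⟨y, hy⟩ p q ∧
        Groupoid.retract _ q = altProd (edgeCocycle i₀) false p)
    (fun x hx _ => ?_) (fun {x w z y} h h' p hp ih hx hy => ?_) p hp
  · exact ⟨𝟙 _, h_nil ⟨x, hx⟩, (Groupoid.retract_id _ _).trans (altProd_nil _).symm⟩
  · obtain ⟨a, hax, haz⟩ := exists_mem_star_inter_of_adj hr h h'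
    have hz : {z} ∈ (G.nbhdComplex r).faces := singleton_mem_faces_of_mem_star haz
    obtain ⟨q, hq, hq'⟩ := ih hz hy
    refine ⟨(G.nbhdCover r).edge ⟨x, hx⟩ ⟨z, hz⟩ ⟨a, hax, haz⟩ ≫ q,
      h_cons ⟨x, hx⟩ ⟨z, hz⟩ ⟨y, hy⟩ w h h' p q _ hq, ?_⟩
    rw [Groupoid.retract_comp, hq', (isCocycle_edgeCocycle i₀).altProd_cons_cons hr,
      edgeCocycle_eq i₀ ⟨x, hx⟩ ⟨z, hz⟩ ⟨a, hax, haz⟩]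

/-- The homomorphism `π₁^{2r}(G, x)_ev → π₁(|N_r(G)|, x)` that sends a walk to the edge path through
its vertices of even index. -/
def evenToFundamentalGroup (hr : 1 ≤ r) :
    G.evenPart (2 * r) i₀.1 →*
      FundamentalGroup (G.nbhdComplex r).Realization ((G.nbhdCover r).pt i₀) :=
  (isCocycle_edgeCocycle i₀).evenHom hr i₀.1

theorem evenToFundamentalGroup_surjective (hr : 1 ≤ r) :
    Function.Surjective (evenToFundamentalGroup i₀ hr) := by
  intro a
  obtain ⟨p, hp, h⟩ := (G.nbhdCover r).edge_induction i₀
    (fun i q => ∃ p : Walk G i₀.1 i.1, Even p.length ∧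
      altProd (edgeCocycle i₀) false p = Groupoid.retract _ q)
    ⟨.nil _, ⟨0, rfl⟩, (altProd_nil _).trans (Groupoid.retract_id _ _).symm⟩
    (fun i j q h => by
      rintro ⟨p, hp, hpq⟩
      obtain ⟨b, hi, hj⟩ := id h
      obtain ⟨w, hw⟩ := exists_mem_nbhd_of_mem_star b
      obtain ⟨s, hs⟩ := Walk.exists_of_mem_nbhd (hw _ hi)
      obtain ⟨t, ht⟩ := Walk.exists_of_mem_nbhd (hw _ hj)
      have hl : (s.reverse.append t).length = 2 * r := by simp; omega
      refine ⟨p.append (s.reverse.append t), ?_, ?_⟩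
      · rw [Walk.length_append, hl]
        exact hp.add (even_two_mul r)
      · have hb : p.length.bodd = false := by
          obtain ⟨k, hk⟩ := hp
          rw [hk, Nat.bodd_add, Bool.xor_self]
        rw [altProd_append, hb, hpq, Groupoid.retract_comp, ← edgeCocycle_eq i₀ i j h]
        exact congrArg (· * _) ((isCocycle_edgeCocycle i₀).altProd_false_eq hr _ hl))
    i₀ a
  refine ⟨⟨PiOne.mk (2 * r) p, p, hp, rfl⟩, ?_⟩
  exact h.trans (Groupoid.retract_loop _ _)

/-- The class of a walk can be read off from the monodromy of its edge path in the covering that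
belongs to `walkCocycle`. -/
theorem evenToFundamentalGroup_injective (hr : 1 ≤ r) :
    Function.Injective (evenToFundamentalGroup i₀ hr) := by
  rw [injective_iff_map_eq_one]
  rintro ⟨_, p, hp, rfl⟩ h1
  let _ : TopologicalSpace (End (⟨i₀.1⟩ : WalkGroupoid G (2 * r))) := ⊥
  have : DiscreteTopology (End (⟨i₀.1⟩ : WalkGroupoid G (2 * r))) := ⟨rfl⟩
  let g : {x : V // {x} ∈ (G.nbhdComplex r).faces} → {x : V // {x} ∈ (G.nbhdComplex r).faces} →
    End (⟨i₀.1⟩ : WalkGroupoid G (2 * r)) := fun i j => walkCocycle G r i₀.1 i.1 j.1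
  have hg : ∀ i j k a, a ∈ (G.nbhdCover r).U i → a ∈ (G.nbhdCover r).U j →
      a ∈ (G.nbhdCover r).U k → g j k * g i j = g i k := fun i j k a hi hj hk => by
    obtain ⟨w, hw⟩ := exists_mem_nbhd_of_mem_star a
    exact isCocycle_walkCocycle i₀.1 w _ _ _ (hw _ hi) (hw _ hj) (hw _ hk)
  obtain ⟨q, hq, hq'⟩ := exists_hom_of_even i₀ hr
    (fun i j p q => ∀ x, (G.nbhdCover r).transport g hg q
      ((G.nbhdCover r).fiberPt g hg i ((G.nbhdCover r).pt i) x) =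
        (G.nbhdCover r).fiberPt g hg j ((G.nbhdCover r).pt j)
          (altProd (walkCocycle G r i₀.1) false p * x))
    (fun i x => by rw [GoodCover.transport_id, altProd_nil, one_mul])
    (fun i k j w h h' p q hik ih x => by
      rw [GoodCover.transport_comp, GoodCover.transport_edge, ih,
        (isCocycle_walkCocycle i₀.1).altProd_cons_cons hr, mul_assoc])
    p hp i₀.2 i₀.2
  have hq1 : q = 𝟙 _ := (Groupoid.retract_loop _ q).symm.trans (hq'.trans h1)
  have h2 := hq 1
  rw [hq1, GoodCover.transport_id] at h2
  have h3 := (G.nbhdCover r).fiberPt_injective g hg i₀ _ ((G.nbhdCover r).pt_mem i₀) h2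
  rw [mul_one, altProd_walkCocycle i₀.1 hr p hp] at h3
  have h4 : p.toHom (2 * r) = (Walk.nil i₀.1).toHom (2 * r) :=
    (Groupoid.retract_loop _ _).symm.trans h3.symm
  exact Subtype.ext (Quotient.sound (Walk.toHom_eq_iff.1 h4))

/-- The homomorphisms `evenToFundamentalGroup` are natural, since a graph map sends edge paths to
edge paths. -/
theorem evenToFundamentalGroup_map (hr : 1 ≤ r) {H : SymGraph W} (f : Hom G H) (v : V)
    (hv : (G.nbrs v).Nonempty) (a : G.evenPart (2 * r) v) :
    evenToFundamentalGroup (G := H) (r := r)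
        ⟨f v, H.singleton_mem_nbhdComplex r (f.nbrs_nonempty hv)⟩ hr (f.mapEvenPart (2 * r) v a) =
      f.mapFundamentalGroup r v hv
        (evenToFundamentalGroup ⟨v, G.singleton_mem_nbhdComplex r hv⟩ hr a) := by
  obtain ⟨_, p, hp, rfl⟩ := a
  have hφ : ∀ i : {x : V // {x} ∈ (G.nbhdComplex r).faces}, {f i.1} ∈ (H.nbhdComplex r).faces :=
    fun i => f.isSimplicialMap r {i.1} {f i.1} i.2 (by simp)
  let φ : {x : V // {x} ∈ (G.nbhdComplex r).faces} → {x : W // {x} ∈ (H.nbhdComplex r).faces} :=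
    fun i => ⟨f i.1, hφ i⟩
  let F := realizationMap (f.isSimplicialMap r)
  have hpt : ∀ i, F ((G.nbhdCover r).pt i) = (H.nbhdCover r).pt (φ i) := fun i =>
    realizationMap_vertexPt (f.isSimplicialMap r) i.1 i.2 (hφ i)
  have hU : ∀ i, ∀ a ∈ (G.nbhdCover r).U i, F a ∈ (H.nbhdCover r).U (φ i) := fun i a ha =>
    realizationMap_mem_star (f.isSimplicialMap r) ha
  let i₀ : {x : V // {x} ∈ (G.nbhdComplex r).faces} := ⟨v, G.singleton_mem_nbhdComplex r hv⟩
  let E := edgeCocycle (G := H) (r := r) (φ i₀)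
  have hE : IsCocycle H r E := isCocycle_edgeCocycle (φ i₀)
  obtain ⟨q, hq, hq'⟩ := exists_hom_of_even i₀ hr
    (fun i j p q => altProd E false (p.map f) =
      Groupoid.retract _ (GoodCover.mapHom F (hpt i) (hpt j) q))
    (fun i => by
      rw [GoodCover.mapHom_id, Groupoid.retract_id]
      exact altProd_nil _)
    (fun i k j w h h' p q hik ih => by
      have hik' : ∃ a, a ∈ (H.nbhdCover r).U (φ i) ∧ a ∈ (H.nbhdCover r).U (φ k) := by
        obtain ⟨a, hi, hk⟩ := hik
        exact ⟨F a, hU i a hi, hU k a hk⟩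
      rw [GoodCover.mapHom_comp F (hpt i) (hpt k) (hpt j), Groupoid.retract_comp, ← ih,
        GoodCover.mapHom_edge _ (H.nbhdCover r) F φ hpt hU i k hik hik',
        ← edgeCocycle_eq (φ i₀) (φ i) (φ k) hik']
      exact hE.altProd_cons_cons hr _ _ _)
    p hp i₀.2 i₀.2
  have h1 : evenToFundamentalGroup i₀ hr ⟨PiOne.mk (2 * r) p, p, hp, rfl⟩ = q :=
    hq'.symm.trans (Groupoid.retract_loop _ q)
  rw [h1]
  exact (hq.trans (Groupoid.retract_loop _ _)).trans
    (FundamentalGroup.mapOfEq_apply F (hpt i₀) q).symm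

end SymGraph

end

theorem theorem5p2 (r : ℕ) (hr : 1 ≤ r) :
    ∃ Φ : ∀ (V : Type u) (G : SymGraph V) (v : V) (hv : (G.nbrs v).Nonempty),
        FundamentalGroup (G.nbhdComplex r).Realization (G.basePt r v hv) ≃*
          G.evenPart (2 * r) v,
      ∀ (V W : Type u) (G : SymGraph V) (H : SymGraph W) (f : SymGraph.Hom G H) (v : V)
        (hv : (G.nbrs v).Nonempty)
        (a : FundamentalGroup (G.nbhdComplex r).Realization (G.basePt r v hv)),
        Φ W H (f v) (f.nbrs_nonempty hv) (f.mapFundamentalGroup r v hv a) =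
          f.mapEvenPart (2 * r) v (Φ V G v hv a) := by
  let Ψ : ∀ (V : Type u) (G : SymGraph V) (v : V) (hv : (G.nbrs v).Nonempty),
      G.evenPart (2 * r) v ≃*
        FundamentalGroup (G.nbhdComplex r).Realization (G.basePt r v hv) := fun V G v hv =>
    MulEquiv.ofBijective
      (SymGraph.evenToFundamentalGroup ⟨v, G.singleton_mem_nbhdComplex r hv⟩ hr)
      ⟨SymGraph.evenToFundamentalGroup_injective _ hr,
        SymGraph.evenToFundamentalGroup_surjective _ hr⟩
  refine ⟨fun V G v hv => (Ψ V G v hv).symm, fun V W G H f v hv a => ?_⟩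
  obtain ⟨b, rfl⟩ := (Ψ V G v hv).surjective a
  rw [MulEquiv.symm_apply_apply, MulEquiv.symm_apply_eq]
  exact (SymGraph.evenToFundamentalGroup_map hr f v hv b).symm
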